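/- **Conventions.** Let $n\ge 0$. A composition of length $n$ is $\alpha=(\alpha_1,\dots,\alpha_n)\in\mathbb Z_{\ge 0}^n$; $\operatorname{inc}(\alpha)$ and $\operatorname{dec}(\alpha)$ are its weakly increasing and weakly decreasing rearrangements, and $\operatorname{rev}(\alpha)=(\alpha_n,\dots,\alpha_1)$. For $\pi\in S_n$ put $\pi\cdot\alpha=(\alpha_{\pi^{-1}(1)},\dots,\alpha_{\pi^{-1}(n)})$. Let $w_0=[n,n-1,\dots,1]$, $\operatorname{rev}(\sigma)=\sigma w_0$ with $(\sigma\pi)_i=\sigma_{\pi_i}$, and let $s_i$ be the transposition of $i$ and $i+1$, acting on $\mathbb Q(q,t)[\mathbf x]=\mathbb Q(q,t)[x_1,\dots,x_n]$ by exchanging $x_i$ and $x_{i+1}$. Define operators on this ring by $$T_i(f)=t\,s_i(f)+(1-t)\,x_{i+1}\frac{f-s_i(f)}{x_i-x_{i+1}}\quad(1\le i\le n-1),\qquad g(f)(x_1,\dots,x_n)=f(x_2,\dots,x_n,q^{-1}x_1),$$ $$Y_i=t^{i-1}T_{i-1}^{-1}\cdots T_1^{-1}\,g\,T_{n-1}\cdots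 T_i\quad(1\le i\le n),$$ and $T_\sigma=T_{i_1}\circ\cdots\circ T_{i_k}$ for a reduced expression $\sigma=s_{i_1}\cdots s_{i_k}$. The nonsymmetric Macdonald polynomial $E_\alpha(\mathbf x;q,t)$ is the unique polynomial in which $\mathbf x^\alpha$ has coefficient $1$ and which satisfies $Y_iE_\alpha=q^{-\alpha_i}t^{k_i}E_\alpha$ for all $i$, where $k_i=|\{j<i:\alpha_j>\alpha_i\}|+|\{j>i:\alpha_j\ge\alpha_i\}|$. The permuted-basement Macdonald polynomial is $$E_\alpha^\sigma=t^{-\operatorname{twinv}(\alpha,\sigma)}\,T_{\operatorname{rev}(\sigma)}E_{\operatorname{rev}(\alpha)},\qquad \operatorname{twinv}(\alpha,\sigma)=|\{(i,j): i<j,\ \alpha_i\ge\alpha_j,\ \sigma_i<\sigma_j\}|.$$ Put $\mathcal A_\alpha^\sigma(\mathbf x;t)=E_\alpha^\sigma(\mathbf x;0,t)$. The $t$-atom polynomial is $\mathcal A_\alpha=\mathcal A_\alpha^{\mathrm{id}}$ and the $t$-key polynomial is $\mathcal K_\alpha=\mathcal A_\alpha^{w_0}$. **Corollary.** These polynomials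 are well defined: for every composition $\beta$ of length $n$ there is exactly one $E_\beta$ with the properties above, and for every $\sigma\in S_n$ no coefficient of $E_\beta^\sigma$ has a pole at $q=0$. Moreover, let $\alpha$ be a composition of length $n$. For every $\tau\in S_n$ (not only the shortest one) with $\tau\cdot\operatorname{inc}(\alpha)=\alpha$, $$\mathcal A_\alpha(\mathbf x;t)=\mathcal A^{\tau}_{\operatorname{inc}(\alpha)}(\mathbf x;t),$$ and for every $\pi\in S_n$ (not only the shortest one) with $\pi\cdot\operatorname{dec}(\alpha)=\alpha$, $$\mathcal K_{\operatorname{rev}(\alpha)}(\mathbf x;t)=\mathcal A^{\pi}_{\operatorname{dec}(\alpha)}(\mathbf x;t).$$ -/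

import Mathlib

namespace PermutedBasement

noncomputable section

/-! ### Compositions and permutations

A composition of length `n` is a function `Fin n → ℕ`. All positions are zero-based. -/

/-- The reversal `rev(α)` of a composition. -/
def rev {n : ℕ} (α : Fin n → ℕ) : Fin n → ℕ := fun i => α (Fin.rev i)

/-- The weakly increasing rearrangement `inc(α)`. -/
def inc {n : ℕ} (α : Fin n → ℕ) : Fin n → ℕ := α ∘ Tuple.sort α

/-- The weakly decreasing rearrangement `dec(α)`. -/
def dec {n : ℕ} (α : Fin n → ℕ) : Fin n → ℕ := rev (inc α)

/-- The left action `(π · α)_i = α_{π⁻¹(i)}`. -/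
def act {n : ℕ} (π : Equiv.Perm (Fin n)) (α : Fin n → ℕ) : Fin n → ℕ := fun i => α (π⁻¹ i)

/-- The permutation `w₀` in one-line notation `[n, n-1, …, 1]`. -/
def w0 (n : ℕ) : Equiv.Perm (Fin n) := Fin.revPerm

/-- The reverse `rev(σ) = σ w₀` of a permutation. -/
def revPerm {n : ℕ} (σ : Equiv.Perm (Fin n)) : Equiv.Perm (Fin n) := σ * w0 n

theorem inc_monotone {n : ℕ} (α : Fin n → ℕ) : Monotone (inc α) := Tuple.monotone_sort α

theorem dec_antitone {n : ℕ} (α : Fin n → ℕ) : Antitone (dec α) :=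
  fun _ _ h => inc_monotone α (Fin.rev_le_rev.mpr h)

/-- The left one of the two positions exchanged by a simple transposition. -/
def lo {n : ℕ} (i : Fin (n - 1)) : Fin n := ⟨i.1, by omega⟩

/-- The right one of the two positions exchanged by a simple transposition. -/
def hi {n : ℕ} (i : Fin (n - 1)) : Fin n := ⟨i.1 + 1, by omega⟩

theorem lo_ne_hi {n : ℕ} (i : Fin (n - 1)) : lo i ≠ hi i := by
  intro h
  have := congrArg Fin.val h
  simp [lo, hi] at this

/-- The simple transposition `s_i`. -/
def simple {n : ℕ} (i : Fin (n - 1)) : Equiv.Perm (Fin n) := Equiv.swap (lo i) (hi i)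

/-- The list `w` of indices is a reduced expression of `σ`: the product of the corresponding
simple transpositions is `σ`, and no shorter list has this property. -/
def IsReduced {n : ℕ} (w : List (Fin (n - 1))) (σ : Equiv.Perm (Fin n)) : Prop :=
  (w.map simple).prod = σ ∧
    ∀ v : List (Fin (n - 1)), (v.map simple).prod = σ → w.length ≤ v.length

theorem exists_word {n : ℕ} (σ : Equiv.Perm (Fin n)) :
    ∃ w : List (Fin (n - 1)), (w.map simple).prod = σ := by
  cases n with
  | zero => exact ⟨[], Subsingleton.elim _ _⟩
  | succ m =>
    have h : σ ∈ Submonoid.closure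
        (Set.range fun i : Fin m => Equiv.swap i.castSucc i.succ) := by
      rw [Equiv.Perm.mclosure_swap_castSucc_succ]; trivial
    induction h using Submonoid.closure_induction with
    | mem x hx =>
      obtain ⟨i, rfl⟩ := hx
      exact ⟨[i], by simp [simple]; rfl⟩
    | one => exact ⟨[], rfl⟩
    | mul x y _ _ hx hy =>
      obtain ⟨a, rfl⟩ := hx
      obtain ⟨b, rfl⟩ := hy
      exact ⟨a ++ b, by simp⟩

theorem exists_isReduced {n : ℕ} (σ : Equiv.Perm (Fin n)) :
    ∃ w : List (Fin (n - 1)), IsReduced w σ := by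
  classical
  have h : ∃ k, ∃ w : List (Fin (n - 1)), (w.map simple).prod = σ ∧ w.length = k := by
    obtain ⟨w, hw⟩ := exists_word σ
    exact ⟨_, w, hw, rfl⟩
  obtain ⟨w, hw, hl⟩ := Nat.find_spec h
  exact ⟨w, hw, fun v hv => hl ▸ Nat.find_min' h ⟨v, hv, rfl⟩⟩

/-- A reduced expression of `σ`. -/
def reducedWord {n : ℕ} (σ : Equiv.Perm (Fin n)) : List (Fin (n - 1)) :=
  (exists_isReduced σ).choose

/-- `twinv(α, σ)`: the number of pairs `i < j` with `α_i ≥ α_j` and `σ_i < σ_j`. -/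
def twinv {n : ℕ} (α : Fin n → ℕ) (σ : Equiv.Perm (Fin n)) : ℕ :=
  (Finset.univ.filter fun p : Fin n × Fin n =>
    p.1 < p.2 ∧ α p.2 ≤ α p.1 ∧ σ p.1 < σ p.2).card

/-! ### The coefficient field and the polynomial ring -/

/-- The field `ℚ(t)`. -/
abbrev Qt : Type := RatFunc ℚ

/-- The field `ℚ(q, t)`, as the field of rational functions in `q` over `ℚ(t)`. -/
abbrev Qqt : Type := RatFunc Qt

/-- The parameter `q`. -/
def q : Qqt := RatFunc.X

/-- The parameter `t`. -/
def t : Qqt := RatFunc.C RatFunc.X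

theorem t_ne_zero : t ≠ 0 := by
  unfold t
  rw [Ne, map_eq_zero]
  exact RatFunc.X_ne_zero

/-- The polynomial ring `ℚ(q, t)[x₁, …, xₙ]`. -/
abbrev Poly (n : ℕ) : Type := MvPolynomial (Fin n) Qqt

/-! ### Demazure–Lusztig operators -/

theorem sub_dvd_sub_rename_swap {n : ℕ} (a b : Fin n) (f : Poly n) :
    (MvPolynomial.X a - MvPolynomial.X b : Poly n) ∣
      f - MvPolynomial.rename (Equiv.swap a b) f := by
  rw [← Ideal.mem_span_singleton, ← Ideal.Quotient.eq]
  set I : Ideal (Poly n) := Ideal.span {MvPolynomial.X a - MvPolynomial.X b}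
  have hab : Ideal.Quotient.mk I (MvPolynomial.X a) = Ideal.Quotient.mk I (MvPolynomial.X b) :=
    Ideal.Quotient.eq.mpr (Ideal.mem_span_singleton_self _)
  have key : Ideal.Quotient.mkₐ Qqt I =
      (Ideal.Quotient.mkₐ Qqt I).comp (MvPolynomial.rename (Equiv.swap a b)) := by
    apply MvPolynomial.algHom_ext
    intro i
    simp only [AlgHom.comp_apply, MvPolynomial.rename_X, Ideal.Quotient.mkₐ_eq_mk]
    rcases eq_or_ne i a with rfl | ha
    · rw [Equiv.swap_apply_left]; exact hab
    · rcases eq_or_ne i b with rfl | hb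
      · rw [Equiv.swap_apply_right]; exact hab.symm
      · rw [Equiv.swap_apply_of_ne_of_ne ha hb]
  exact congrArg (fun φ : Poly n →ₐ[Qqt] (Poly n ⧸ I) => φ f) key

/-- The action of the simple transposition `s_i` on polynomials, permuting the variables. -/
def sAct {n : ℕ} (i : Fin (n - 1)) : Poly n →ₐ[Qqt] Poly n := MvPolynomial.rename (simple i)

/-- The divided difference `(f - s_i f) / (x_i - x_{i+1})`, a polynomial. -/
def dividedDiff {n : ℕ} (i : Fin (n - 1)) (f : Poly n) : Poly n :=
  (sub_dvd_sub_rename_swap (lo i) (hi i) f).choose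

theorem dividedDiff_spec {n : ℕ} (i : Fin (n - 1)) (f : Poly n) :
    f - sAct i f = (MvPolynomial.X (lo i) - MvPolynomial.X (hi i)) * dividedDiff i f :=
  (sub_dvd_sub_rename_swap (lo i) (hi i) f).choose_spec

theorem X_lo_sub_X_hi_ne_zero {n : ℕ} (i : Fin (n - 1)) :
    (MvPolynomial.X (lo i) - MvPolynomial.X (hi i) : Poly n) ≠ 0 := by
  rw [sub_ne_zero]
  exact fun h => lo_ne_hi i (MvPolynomial.X_injective h)

theorem dividedDiff_unique {n : ℕ} (i : Fin (n - 1)) (f d : Poly n)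
    (h : f - sAct i f = (MvPolynomial.X (lo i) - MvPolynomial.X (hi i)) * d) :
    dividedDiff i f = d :=
  mul_left_cancel₀ (X_lo_sub_X_hi_ne_zero i) ((dividedDiff_spec i f).symm.trans h)

/-- The Demazure–Lusztig operator
`T_i f = t s_i(f) + (1 - t) x_{i+1} (f - s_i(f)) / (x_i - x_{i+1})`. -/
def T {n : ℕ} (i : Fin (n - 1)) : Module.End Qqt (Poly n) where
  toFun f := t • sAct i f + (1 - t) • (MvPolynomial.X (hi i) * dividedDiff i f)
  map_add' f g := by
    have h : dividedDiff i (f + g) = dividedDiff i f + dividedDiff i g := by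
      apply dividedDiff_unique
      rw [mul_add, ← dividedDiff_spec, ← dividedDiff_spec, map_add]
      ring
    rw [h, map_add, mul_add, smul_add, smul_add]
    abel
  map_smul' c f := by
    have h : dividedDiff i (c • f) = c • dividedDiff i f := by
      apply dividedDiff_unique
      rw [mul_smul_comm, ← dividedDiff_spec, map_smul, smul_sub]
    rw [h, map_smul, RingHom.id_apply, mul_smul_comm, smul_add, smul_comm c t,
      smul_comm c (1 - t)]

theorem T_apply {n : ℕ} (i : Fin (n - 1)) (f : Poly n) :
    T i f = t • sAct i f + (1 - t) • (MvPolynomial.X (hi i) * dividedDiff i f) := rfl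

/-- The quadratic relation of the Demazure–Lusztig operators. -/
theorem T_mul_T {n : ℕ} (i : Fin (n - 1)) : T i * T i = (t - 1) • T i + t • 1 := by
  refine LinearMap.ext fun f => ?_
  have hss : ∀ p : Poly n, sAct i (sAct i p) = p := fun p => by
    have hc : (simple i : Fin n → Fin n) ∘ simple i = id := by
      funext x; simp [simple]
    rw [sAct, MvPolynomial.rename_rename, hc, MvPolynomial.rename_id_apply]
  have hlo : sAct i (MvPolynomial.X (lo i)) = MvPolynomial.X (hi i) := by
    simp [sAct, simple]
  have hhi : sAct i (MvPolynomial.X (hi i)) = MvPolynomial.X (lo i) := by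
    simp [sAct, simple]
  have hspec := dividedDiff_spec i f
  have hsD : sAct i (dividedDiff i f) = dividedDiff i f := by
    apply mul_left_cancel₀ (X_lo_sub_X_hi_ne_zero i)
    have h := congrArg (sAct i) hspec
    rw [map_sub, map_mul, map_sub, hss, hlo, hhi] at h
    linear_combination h + hspec
  have hsT : sAct i (T i f) = t • f + (1 - t) • (MvPolynomial.X (lo i) * dividedDiff i f) := by
    rw [T_apply, map_add, map_smul, map_smul, map_mul, hss, hhi, hsD]
  have hDT : dividedDiff i (T i f) = -dividedDiff i f := by
    apply dividedDiff_unique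
    rw [hsT, T_apply]
    simp only [MvPolynomial.smul_eq_C_mul, map_sub, map_one]
    linear_combination (-MvPolynomial.C t) * hspec
  rw [Module.End.mul_apply, T_apply i (T i f), hsT, hDT]
  simp only [LinearMap.add_apply, LinearMap.smul_apply, Module.End.one_apply, T_apply,
    MvPolynomial.smul_eq_C_mul, map_sub, map_one]
  linear_combination (-MvPolynomial.C t + MvPolynomial.C t ^ 2) * hspec

/-- The Demazure–Lusztig operator `T_i` as an invertible operator. -/
def TUnit {n : ℕ} (i : Fin (n - 1)) : (Module.End Qqt (Poly n))ˣ where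
  val := T i
  inv := t⁻¹ • (T i + (1 - t) • 1)
  val_inv := by
    rw [mul_smul_comm, mul_add, T_mul_T, mul_smul_comm, mul_one, inv_smul_eq_iff₀ t_ne_zero]
    rw [add_right_comm, ← add_smul, sub_add_sub_cancel', sub_self, zero_smul, zero_add]
  inv_val := by
    rw [smul_mul_assoc, add_mul, T_mul_T, smul_mul_assoc, one_mul, inv_smul_eq_iff₀ t_ne_zero]
    rw [add_right_comm, ← add_smul, sub_add_sub_cancel', sub_self, zero_smul, zero_add]

/-- `T_σ`, the composition of the Demazure–Lusztig operators along a reduced expression of `σ`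
(multiplication in `Module.End` is composition). -/
def TPerm {n : ℕ} (σ : Equiv.Perm (Fin n)) : Module.End Qqt (Poly n) :=
  ((reducedWord σ).map T).prod

/-! ### Cherednik–Dunkl operators -/

/-- The operator `g f(x₁, …, xₙ) = f(x₂, …, xₙ, q⁻¹ x₁)`. -/
def g (n : ℕ) : Poly n →ₐ[Qqt] Poly n :=
  MvPolynomial.aeval fun i : Fin n =>
    if h : i.1 + 1 < n then MvPolynomial.X ⟨i.1 + 1, h⟩
    else MvPolynomial.C q⁻¹ * MvPolynomial.X ⟨0, i.pos⟩

/-- The Cherednik–Dunkl operator `Y_i = t^{i-1} T_{i-1}⁻¹ ⋯ T_1⁻¹ g T_{n-1} ⋯ T_i`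
(`i` being one-based in this formula and zero-based in the code). -/
def Y {n : ℕ} (i : Fin n) : Module.End Qqt (Poly n) :=
  t ^ i.1 •
    (((((List.finRange (n - 1)).filter fun j => j.1 < i.1).reverse.map
        fun j => (↑(TUnit j)⁻¹ : Module.End Qqt (Poly n))).prod) *
      (g n).toLinearMap *
      (((List.finRange (n - 1)).filter fun j => i.1 ≤ j.1).reverse.map T).prod)

/-! ### Macdonald polynomials -/

/-- `k_i = #{j < i : α_j > α_i} + #{j > i : α_j ≥ α_i}`. -/
def kExp {n : ℕ} (α : Fin n → ℕ) (i : Fin n) : ℕ :=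
  (Finset.univ.filter fun j : Fin n => j < i ∧ α i < α j).card +
    (Finset.univ.filter fun j : Fin n => i < j ∧ α i ≤ α j).card

/-- The properties that characterize the nonsymmetric Macdonald polynomial `E_α`: the coefficient
of `x^α` is `1`, and `Y_i E_α = q^{-α_i} t^{k_i} E_α` for all `i`. -/
def IsNonsymmetricMacdonald {n : ℕ} (α : Fin n → ℕ) (E : Poly n) : Prop :=
  MvPolynomial.coeff (Finsupp.equivFunOnFinite.symm α) E = 1 ∧
    ∀ i : Fin n, Y i E = (q⁻¹ ^ α i * t ^ kExp α i) • E

open Classical in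
/-- The nonsymmetric Macdonald polynomial `E_α`, the polynomial with the above properties. -/
def nonsymmetricMacdonald {n : ℕ} (α : Fin n → ℕ) : Poly n :=
  if h : ∃ E : Poly n, IsNonsymmetricMacdonald α E then h.choose else 0

/-- The permuted-basement Macdonald polynomial
`E_α^σ = t^{-twinv(α, σ)} T_{rev(σ)} E_{rev(α)}`. -/
def permutedMacdonald {n : ℕ} (α : Fin n → ℕ) (σ : Equiv.Perm (Fin n)) : Poly n :=
  t⁻¹ ^ twinv α σ • TPerm (revPerm σ) (nonsymmetricMacdonald (rev α))

/-! ### Specialization at `q = 0` -/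

/-- The rational function `c ∈ ℚ(t)(q)` has no pole at `q = 0`. -/
def RegularAtZero (c : Qqt) : Prop := c.denom.eval 0 ≠ 0

/-- The value in `ℚ(t)` at `q = 0` of a rational function in `q`, taken as the quotient of the
values of its numerator and denominator in lowest terms (meaningful if there is no pole). -/
def evalZero (c : Qqt) : Qt := RatFunc.eval (RingHom.id Qt) 0 c

/-- The specialization `f(x; 0, t)`, coefficient by coefficient. -/
def specialize {n : ℕ} (f : Poly n) : MvPolynomial (Fin n) Qt :=
  ∑ m ∈ f.support, MvPolynomial.monomial m (evalZero (MvPolynomial.coeff m f))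

/-- The permuted-basement `t`-atom `A_α^σ(x; t) = E_α^σ(x; 0, t)`. -/
def permutedAtom {n : ℕ} (α : Fin n → ℕ) (σ : Equiv.Perm (Fin n)) : MvPolynomial (Fin n) Qt :=
  specialize (permutedMacdonald α σ)

/-- The `t`-atom polynomial `A_α = A_α^{id}`. -/
def tAtom {n : ℕ} (α : Fin n → ℕ) : MvPolynomial (Fin n) Qt := permutedAtom α 1

/-- The `t`-key polynomial `K_α = A_α^{w₀}`. -/
def tKey {n : ℕ} (α : Fin n → ℕ) : MvPolynomial (Fin n) Qt := permutedAtom α (w0 n)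

end

end PermutedBasement

/-! Everything rests on how the `T_i` act on the `E_α` modulo `q`.

The `T_i` and `Y_i` satisfy affine Hecke relations, and `Φ = x_1 g` satisfies `Y_1 Φ = q⁻¹ Φ Y_n`
and `Y_{i+1} Φ = Φ Y_i`. This gives the Knop–Sahi recursion for joint eigenvectors. If `α_i >
α_{i+1}`, then `T_i + c` with a suitable scalar `c` turns `E_α` into `E_{s_i α}`
(`IsTriangularMacdonald.swap`), and `q^{α_n} Φ` turns `E_α` into `E_{(α_n + 1, α_1, …, α_{n-1})}`
(`IsTriangularMacdonald.raise`). Starting from `E_0 = 1`, these moves reach every composition. Both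
preserve triangularity for a Bruhat-type order and regularity at `q = 0`. Triangularity makes the
constructed polynomials a basis, and their spectra are pairwise distinct, so each `E_α` is unique.
The eigenvectors are built explicitly, so commutativity of the `Y_i` is never needed.

The scalar is `c = (1 - t) + q e` with `e` regular. If `α_i < α_{i+1}`, then `E_α = (T_i + c) E_{s_i
α}`, and the quadratic relation gives `T_i E_α ≡ t E_{s_i α}` modulo `q`. If `α_i = α_{i+1}`, then
`T_i E_α = t E_α` exactly. Along a reduced word this becomes `T_σ E_α ≡ t^{ℓ(σ)} E_{σ·α}` whenever
`α_x ≤ α_y` for every inversion `x < y` of `σ` (`TPerm_nonsymmetricMacdonald_congr`).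

For keys this is applied to `σ = π w₀` and the increasing composition `rev(dec α)`, where the
condition is automatic. For atoms, `w₀ = (τ w₀) ρ` with `ρ = w₀ τ⁻¹ w₀` and additive lengths, and
the congruence is applied to `T_ρ E_{rev α}`. In both cases the powers of `t` cancel against
`twinv`. Only inversions enter, so neither `τ` nor `π` has to be shortest. -/

namespace PermutedBasement

noncomputable section

open MvPolynomial

/-! ### Relations between the Demazure–Lusztig operators -/

theorem simple_lo {n : ℕ} (i : Fin (n - 1)) : simple i (lo i) = hi i :=
  Equiv.swap_apply_left _ _

theorem simple_hi {n : ℕ} (i : Fin (n - 1)) : simple i (hi i) = lo i :=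
  Equiv.swap_apply_right _ _

theorem simple_of_ne {n : ℕ} (i : Fin (n - 1)) {j : Fin n} (h₁ : j ≠ lo i) (h₂ : j ≠ hi i) :
    simple i j = j :=
  Equiv.swap_apply_of_ne_of_ne h₁ h₂

theorem simple_mul_self {n : ℕ} (i : Fin (n - 1)) : simple i * simple i = 1 :=
  Equiv.swap_mul_self _ _

theorem simple_simple {n : ℕ} (i : Fin (n - 1)) (j : Fin n) : simple i (simple i j) = j :=
  Equiv.swap_apply_self _ _ _

theorem simple_inv {n : ℕ} (i : Fin (n - 1)) : (simple i)⁻¹ = simple i :=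
  Equiv.swap_inv _ _

theorem sub_mul_T {n : ℕ} (i : Fin (n - 1)) (f : Poly n) :
    (X (lo i) - X (hi i)) * T i f =
      C t * (X (lo i) - X (hi i)) * sAct i f + (1 - C t) * X (hi i) * (f - sAct i f) := by
  rw [T_apply, dividedDiff_spec]
  simp only [smul_eq_C_mul, map_sub, map_one]
  ring

theorem T_unique {n : ℕ} (i : Fin (n - 1)) (f p : Poly n)
    (h : (X (lo i) - X (hi i)) * p =
      C t * (X (lo i) - X (hi i)) * sAct i f + (1 - C t) * X (hi i) * (f - sAct i f)) :
    T i f = p :=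
  mul_left_cancel₀ (X_lo_sub_X_hi_ne_zero i) ((sub_mul_T i f).trans h.symm)

theorem T_mul_of_invariant {n : ℕ} (i : Fin (n - 1)) {p : Poly n} (hp : sAct i p = p)
    (f : Poly n) : T i (p * f) = p * T i f := by
  apply T_unique
  rw [map_mul, hp]
  linear_combination p * sub_mul_T i f

theorem T_one {n : ℕ} (i : Fin (n - 1)) : T i (1 : Poly n) = t • 1 := by
  apply T_unique
  rw [map_one, smul_eq_C_mul]
  ring

theorem sAct_X {n : ℕ} (i : Fin (n - 1)) (j : Fin n) : sAct i (X j) = X (simple i j) :=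
  rename_X _ _

theorem T_X_lo_mul {n : ℕ} (i : Fin (n - 1)) (f : Poly n) :
    T i (X (lo i) * f) = X (hi i) * (T i f + (1 - t) • f) := by
  apply T_unique
  rw [map_mul, sAct_X, simple_lo]
  simp only [smul_eq_C_mul, map_sub, map_one]
  linear_combination X (hi i) * sub_mul_T i f

/-- Multiplication by the variable `x_j`. -/
def mulX {n : ℕ} (j : Fin n) : Module.End Qqt (Poly n) := LinearMap.mulLeft Qqt (X j)

theorem mulX_apply {n : ℕ} (j : Fin n) (f : Poly n) : mulX j f = X j * f := rfl

theorem coe_inv_TUnit {n : ℕ} (i : Fin (n - 1)) :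
    (↑(TUnit i)⁻¹ : Module.End Qqt (Poly n)) = t⁻¹ • (T i + (1 - t) • 1) := rfl

theorem T_mul_mulX {n : ℕ} (i : Fin (n - 1)) :
    T i * mulX (lo i) = t • (mulX (hi i) * (↑(TUnit i)⁻¹ : Module.End Qqt (Poly n))) := by
  refine LinearMap.ext fun f => ?_
  rw [coe_inv_TUnit, mul_smul_comm, smul_smul, mul_inv_cancel₀ t_ne_zero, one_smul]
  simp [mulX_apply, T_X_lo_mul]

theorem T_mul_mulX_of_ne {n : ℕ} (i : Fin (n - 1)) {j : Fin n} (h₁ : j ≠ lo i) (h₂ : j ≠ hi i) :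
    T i * mulX j = mulX j * T i := by
  refine LinearMap.ext fun f => ?_
  simp only [Module.End.mul_apply, mulX_apply]
  exact T_mul_of_invariant i (by rw [sAct_X, simple_of_ne i h₁ h₂]) f

/-- In the fraction field, and with an arbitrary permutation `w` applied outside, the expansion of
`T_i f` involves `f` only through its permuted copies. Iterating it turns the commutation and braid
relations into identities of rational functions in the variables. -/
theorem algebraMap_rename_T {n : ℕ} (w : Equiv.Perm (Fin n)) (i : Fin (n - 1)) (f : Poly n) :
    algebraMap (Poly n) (FractionRing (Poly n)) (rename w (T i f)) =
      algebraMap _ _ (C t : Poly n) * algebraMap _ _ (rename (w * simple i) f) +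
      (1 - algebraMap _ _ (C t : Poly n)) * algebraMap _ _ (X (w (hi i)) : Poly n) *
        (algebraMap _ _ (rename w f) - algebraMap _ _ (rename (w * simple i) f)) /
        (algebraMap _ _ (X (w (lo i)) : Poly n) - algebraMap _ _ (X (w (hi i)) : Poly n)) := by
  have hne : algebraMap (Poly n) (FractionRing (Poly n)) (X (w (lo i))) -
      algebraMap _ _ (X (w (hi i)) : Poly n) ≠ 0 := by
    rw [sub_ne_zero]
    intro h
    exact lo_ne_hi i (w.injective (X_injective (IsFractionRing.injective _ _ h)))
  have hs : rename w (sAct i f) = rename (w * simple i) f := by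
    rw [sAct, rename_rename]; rfl
  have h := congrArg (fun p => algebraMap (Poly n) (FractionRing (Poly n)) (rename w p))
    (sub_mul_T i f)
  simp only [map_mul, map_sub, map_add, map_one, rename_X, hs, rename_C] at h
  rw [eq_comm, ← sub_eq_zero]
  field_simp
  linear_combination -h

theorem rename_one {n : ℕ} (f : Poly n) : rename (1 : Equiv.Perm (Fin n)) f = f :=
  rename_id_apply f

theorem simple_braid {n : ℕ} {i j : Fin (n - 1)} (h : i.1 + 1 = j.1) :
    simple i * simple j * simple i = simple j * simple i * simple j := by
  have e : lo j = hi i := Fin.ext h.symm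
  have h1 : hi j ≠ hi i := e ▸ (lo_ne_hi j).symm
  have h3 : lo i ≠ hi j := by
    intro h'
    have := congrArg Fin.val h'
    simp [lo, hi] at this
    omega
  unfold simple
  rw [e, Equiv.swap_mul_swap_mul_swap (lo_ne_hi i) h3, Equiv.swap_comm (lo i) (hi i),
    Equiv.swap_comm (hi i) (hi j), Equiv.swap_mul_swap_mul_swap h1 h3.symm, Equiv.swap_comm]

theorem simple_comm {n : ℕ} {i j : Fin (n - 1)} (h : i.1 + 1 < j.1) :
    simple i * simple j = simple j * simple i := by
  unfold simple
  refine (Equiv.Perm.Disjoint.commute ?_).eq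
  rw [Equiv.Perm.disjoint_iff_disjoint_support, Equiv.Perm.support_swap (lo_ne_hi i),
    Equiv.Perm.support_swap (lo_ne_hi j)]
  simp [lo, hi, Fin.ext_iff]
  omega

theorem T_comm {n : ℕ} {i j : Fin (n - 1)} (h : i.1 + 1 < j.1) : T i * T j = T j * T i := by
  refine LinearMap.ext fun f => IsFractionRing.injective (Poly n) (FractionRing (Poly n)) ?_
  have key := fun w i f => algebraMap_rename_T (n := n) w i f
  have d1 : ∀ a b : Fin n, a ≠ b → algebraMap (Poly n) (FractionRing (Poly n)) (X a) -
      algebraMap _ _ (X b : Poly n) ≠ 0 := by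
    intro a b hab
    rw [sub_ne_zero]
    exact fun h => hab (X_injective (IsFractionRing.injective _ _ h))
  have n1 := d1 _ _ (lo_ne_hi i)
  have n2 := d1 _ _ (lo_ne_hi j)
  have e1 : simple i (lo j) = lo j := simple_of_ne i (by simp [lo, Fin.ext_iff]; omega)
    (by simp [lo, hi, Fin.ext_iff]; omega)
  have e2 : simple i (hi j) = hi j := simple_of_ne i (by simp [lo, hi, Fin.ext_iff]; omega)
    (by simp [hi, Fin.ext_iff]; omega)
  have e3 : simple j (lo i) = lo i := simple_of_ne j (by simp [lo, Fin.ext_iff]; omega)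
    (by simp [lo, hi, Fin.ext_iff]; omega)
  have e4 : simple j (hi i) = hi i := simple_of_ne j (by simp [lo, hi, Fin.ext_iff]; omega)
    (by simp [hi, Fin.ext_iff]; omega)
  simp only [Module.End.mul_apply]
  -- The trivial permutation is inserted so that `key` can expand the outermost operator.
  rw [← rename_one (T i (T j f)), ← rename_one (T j (T i f))]
  simp only [key, one_mul, Equiv.Perm.one_apply, e1, e2, e3, e4, simple_comm h]
  field_simp
  ring

theorem T_braid {n : ℕ} {i j : Fin (n - 1)} (h : i.1 + 1 = j.1) :
    T i * T j * T i = T j * T i * T j := by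
  refine LinearMap.ext fun f => IsFractionRing.injective (Poly n) (FractionRing (Poly n)) ?_
  have key := fun w i f => algebraMap_rename_T (n := n) w i f
  have d1 : ∀ a b : Fin n, a ≠ b → algebraMap (Poly n) (FractionRing (Poly n)) (X a) -
      algebraMap _ _ (X b : Poly n) ≠ 0 := by
    intro a b hab
    rw [sub_ne_zero]
    exact fun h => hab (X_injective (IsFractionRing.injective _ _ h))
  have e : lo j = hi i := Fin.ext h.symm
  have h3 : lo i ≠ hi j := by
    intro h'
    have := congrArg Fin.val h'
    simp [lo, hi] at this
    omega
  have n1 := d1 _ _ (lo_ne_hi i)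
  have n1' := d1 _ _ (lo_ne_hi i).symm
  have n2 := d1 _ _ (e ▸ lo_ne_hi j)
  have n2' := d1 _ _ (e ▸ lo_ne_hi j).symm
  have n3 := d1 _ _ h3
  have n3' := d1 _ _ h3.symm
  have e1 : simple i (hi j) = hi j := simple_of_ne i h3.symm (e ▸ (lo_ne_hi j).symm)
  have e2 : simple j (hi i) = hi j := e ▸ simple_lo j
  have e2' : simple j (hi j) = hi i := e ▸ simple_hi j
  have e3 : simple j (lo i) = lo i := simple_of_ne j (e ▸ lo_ne_hi i) h3
  have hb : simple i * (simple j * simple i) = simple j * (simple i * simple j) := by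
    simpa only [mul_assoc] using simple_braid h
  simp only [Module.End.mul_apply]
  rw [← rename_one (T i (T j (T i f))), ← rename_one (T j (T i (T j f)))]
  simp only [key, one_mul, Equiv.Perm.one_apply, Equiv.Perm.mul_apply, e, e1, e2, e2', e3,
    simple_lo, simple_hi, simple_mul_self, mul_assoc, hb]
  field_simp
  ring

/-! ### The operator `g` and the Demazure–Lusztig operators -/

theorem g_X_of_lt {n : ℕ} (j : Fin n) (h : j.1 + 1 < n) : g n (X j) = X ⟨j.1 + 1, h⟩ := by
  simp [g, h]

theorem g_X_last {n : ℕ} (j : Fin n) (h : j.1 + 1 = n) : g n (X j) = C q⁻¹ * X ⟨0, j.pos⟩ := by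
  simp [g, h]

theorem g_C {n : ℕ} (c : Qqt) : g n (C c) = C c := algHom_C _ _

theorem sAct_C {n : ℕ} (i : Fin (n - 1)) (c : Qqt) : sAct i (C c) = C c := algHom_C _ _

theorem g_sAct {n : ℕ} {i j : Fin (n - 1)} (h : i.1 + 1 = j.1) (f : Poly n) :
    g n (sAct i f) = sAct j (g n f) := by
  suffices (g n).comp (sAct i) = (sAct j).comp (g n) from DFunLike.congr_fun this f
  have hi' : (hi i).1 + 1 < n := by simp only [hi]; omega
  have hlo : (lo i).1 + 1 < n := by simp only [lo]; omega
  have e1 : (⟨(lo i).1 + 1, hlo⟩ : Fin n) = lo j := Fin.ext h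
  have e2 : (⟨(hi i).1 + 1, hi'⟩ : Fin n) = hi j := Fin.ext (congrArg (· + 1) h)
  refine algHom_ext fun k => ?_
  simp only [AlgHom.comp_apply, sAct_X]
  rcases eq_or_ne k (lo i) with rfl | h1
  · rw [simple_lo, g_X_of_lt _ hi', g_X_of_lt _ hlo, sAct_X, e1, e2, simple_lo]
  rcases eq_or_ne k (hi i) with rfl | h2
  · rw [simple_hi, g_X_of_lt _ hi', g_X_of_lt _ hlo, sAct_X, e1, e2, simple_hi]
  rw [simple_of_ne i h1 h2]
  simp only [lo, hi, Fin.ext_iff, ne_eq] at h1 h2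
  by_cases hk : k.1 + 1 < n
  · rw [g_X_of_lt k hk, sAct_X, simple_of_ne]
    · simp [lo, Fin.ext_iff]; omega
    · simp [hi, Fin.ext_iff]; omega
  · rw [g_X_last k (by omega), map_mul, sAct_C, sAct_X, simple_of_ne]
    · simp [lo, Fin.ext_iff]; omega
    · simp [hi, Fin.ext_iff]

theorem g_mul_T {n : ℕ} {i j : Fin (n - 1)} (h : i.1 + 1 = j.1) :
    (g n).toLinearMap * T i = T j * (g n).toLinearMap := by
  refine LinearMap.ext fun f => ?_
  simp only [Module.End.mul_apply, AlgHom.toLinearMap_apply]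
  symm
  apply T_unique
  have h1 : g n (X (lo i)) = X (lo j) := by
    rw [g_X_of_lt _ (by simp only [lo]; omega)]
    simp only [lo, h]
  have h2 : g n (X (hi i)) = X (hi j) := by
    rw [g_X_of_lt _ (by simp only [hi]; omega)]
    simp only [hi, h]
  have := congrArg (g n) (sub_mul_T i f)
  simpa only [map_mul, map_sub, map_add, map_one, h1, h2, g_sAct h, g_C] using this

theorem g_g_X_lo {n : ℕ} {i z : Fin (n - 1)} (hi' : i.1 + 2 = n) (hz : z.1 = 0) :
    g n (g n (X (lo i))) = C q⁻¹ * X (lo z) := by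
  rw [g_X_of_lt _ (by simp only [lo]; omega), g_X_last _ (by simp only [lo]; omega)]
  simp only [lo, hz]

theorem g_g_X_hi {n : ℕ} {i z : Fin (n - 1)} (hi' : i.1 + 2 = n) (hz : z.1 = 0) :
    g n (g n (X (hi i))) = C q⁻¹ * X (hi z) := by
  rw [g_X_last _ (by simp only [hi]; omega), map_mul, g_C,
    g_X_of_lt _ (by simp only []; omega)]
  simp only [hi, hz]

theorem g_g_sAct {n : ℕ} {i z : Fin (n - 1)} (hi' : i.1 + 2 = n) (hz : z.1 = 0) (f : Poly n) :
    g n (g n (sAct i f)) = sAct z (g n (g n f)) := by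
  suffices ((g n).comp (g n)).comp (sAct i) = (sAct z).comp ((g n).comp (g n)) from
    DFunLike.congr_fun this f
  refine algHom_ext fun k => ?_
  simp only [AlgHom.comp_apply, sAct_X]
  rcases eq_or_ne k (lo i) with rfl | h1
  · rw [simple_lo, g_g_X_hi hi' hz, g_g_X_lo hi' hz, map_mul, sAct_C, sAct_X, simple_lo]
  rcases eq_or_ne k (hi i) with rfl | h2
  · rw [simple_hi, g_g_X_hi hi' hz, g_g_X_lo hi' hz, map_mul, sAct_C, sAct_X, simple_hi]
  rw [simple_of_ne i h1 h2]
  simp only [lo, hi, Fin.ext_iff, ne_eq] at h1 h2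
  have hk := k.2
  rw [g_X_of_lt k (by omega), g_X_of_lt _ (by simp only []; omega), sAct_X, simple_of_ne]
  · simp [lo, Fin.ext_iff]; omega
  · simp [hi, Fin.ext_iff]; omega

/-- Applying `g` twice carries the last two variables to `q⁻¹ x_1` and `q⁻¹ x_2`. The formula for
`T_i` is homogeneous, so the common factor `q⁻¹` drops out. This is the wrap-around case of
`g_mul_T`. -/
theorem g_mul_g_mul_T {n : ℕ} {i z : Fin (n - 1)} (hi' : i.1 + 2 = n) (hz : z.1 = 0) :
    (g n).toLinearMap * (g n).toLinearMap * T i =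
      T z * ((g n).toLinearMap * (g n).toLinearMap) := by
  refine LinearMap.ext fun f => ?_
  simp only [Module.End.mul_apply, AlgHom.toLinearMap_apply]
  symm
  apply T_unique
  have hq : (C q⁻¹ : Poly n) ≠ 0 := by
    rw [Ne, map_eq_zero]
    exact inv_ne_zero RatFunc.X_ne_zero
  apply mul_left_cancel₀ hq
  have := congrArg (fun p => g n (g n p)) (sub_mul_T i f)
  simp only [map_mul, map_sub, map_add, map_one, g_g_X_lo hi' hz, g_g_X_hi hi' hz,
    g_g_sAct hi' hz, g_C] at this
  linear_combination this

/-! ### Relations between the Cherednik–Dunkl operators and the Demazure–Lusztig operators -/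

theorem filter_finRange_lt {N k : ℕ} :
    (List.finRange N).filter (fun j => decide (j.1 < k)) = (List.finRange N).take k := by
  conv_lhs => rw [← List.take_append_drop k (List.finRange N)]
  rw [List.filter_append, List.filter_eq_self.mpr, List.filter_eq_nil_iff.mpr, List.append_nil]
  · intro a ha
    obtain ⟨m, hm, rfl⟩ := List.mem_iff_getElem.mp ha
    simp
  · intro a ha
    obtain ⟨m, hm, rfl⟩ := List.mem_iff_getElem.mp ha
    simp at hm ⊢
    omega

theorem filter_finRange_le {N k : ℕ} :
    (List.finRange N).filter (fun j => decide (k ≤ j.1)) = (List.finRange N).drop k := by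
  conv_lhs => rw [← List.take_append_drop k (List.finRange N)]
  rw [List.filter_append, List.filter_eq_nil_iff.mpr, List.filter_eq_self.mpr, List.nil_append]
  · intro a ha
    obtain ⟨m, hm, rfl⟩ := List.mem_iff_getElem.mp ha
    simp
  · intro a ha
    obtain ⟨m, hm, rfl⟩ := List.mem_iff_getElem.mp ha
    simp at hm ⊢
    omega

/-- The operator `T_{n-1} ⋯ T_{k+1}`. -/
def tailT (n k : ℕ) : Module.End Qqt (Poly n) :=
  (((List.finRange (n - 1)).filter fun j => k ≤ j.1).reverse.map T).prod

/-- The operator `T_k⁻¹ ⋯ T_1⁻¹`. -/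
def headInv (n k : ℕ) : Module.End Qqt (Poly n) :=
  (((List.finRange (n - 1)).filter fun j => j.1 < k).reverse.map
    fun j => (↑(TUnit j)⁻¹ : Module.End Qqt (Poly n))).prod

theorem Y_eq {n : ℕ} (i : Fin n) :
    Y i = t ^ i.1 • (headInv n i.1 * (g n).toLinearMap * tailT n i.1) := rfl

theorem tailT_step {n : ℕ} (i : Fin (n - 1)) : tailT n i.1 = tailT n (i.1 + 1) * T i := by
  simp only [tailT, filter_finRange_le]
  rw [List.drop_eq_getElem_cons (by simp)]
  simp

theorem tailT_of_le {n k : ℕ} (h : n - 1 ≤ k) : tailT n k = 1 := by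
  simp only [tailT, filter_finRange_le]
  rw [List.drop_eq_nil_of_le (by simpa using h)]
  simp

theorem headInv_zero (n : ℕ) : headInv n 0 = 1 := by
  simp [headInv]

theorem headInv_step {n : ℕ} (i : Fin (n - 1)) :
    headInv n (i.1 + 1) = (↑(TUnit i)⁻¹ : Module.End Qqt (Poly n)) * headInv n i.1 := by
  simp only [headInv, filter_finRange_lt]
  rw [List.take_succ_eq_append_getElem (by simp)]
  simp

theorem T_mul_inv {n : ℕ} (i : Fin (n - 1)) :
    T i * (↑(TUnit i)⁻¹ : Module.End Qqt (Poly n)) = 1 := (TUnit i).mul_inv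

theorem inv_mul_T {n : ℕ} (i : Fin (n - 1)) :
    (↑(TUnit i)⁻¹ : Module.End Qqt (Poly n)) * T i = 1 := (TUnit i).inv_mul

/-- `Y_{i+1} = t T_i⁻¹ Y_i T_i⁻¹`. -/
theorem Y_hi {n : ℕ} (i : Fin (n - 1)) :
    Y (hi i) = t • ((↑(TUnit i)⁻¹ : Module.End Qqt (Poly n)) * Y (lo i) *
      (↑(TUnit i)⁻¹ : Module.End Qqt (Poly n))) := by
  rw [Y_eq, Y_eq]
  simp only [lo, hi]
  rw [headInv_step, tailT_step, mul_smul_comm, smul_mul_assoc, smul_smul, ← pow_succ']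
  simp only [mul_assoc, T_mul_inv, mul_one]

theorem T_mul_Y_hi {n : ℕ} (i : Fin (n - 1)) :
    T i * Y (hi i) = Y (lo i) * (T i + (1 - t) • 1) := by
  rw [Y_hi, coe_inv_TUnit, ← coe_inv_TUnit, mul_smul_comm, ← mul_assoc, ← mul_assoc, T_mul_inv,
    one_mul, coe_inv_TUnit, mul_smul_comm, smul_smul, mul_inv_cancel₀ t_ne_zero, one_smul]

theorem Y_hi_mul_T {n : ℕ} (i : Fin (n - 1)) :
    Y (hi i) * T i = (T i + (1 - t) • 1) * Y (lo i) := by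
  rw [Y_hi, smul_mul_assoc, mul_assoc, inv_mul_T, mul_one, coe_inv_TUnit, smul_mul_assoc,
    smul_smul, mul_inv_cancel₀ t_ne_zero, one_smul]

theorem T_commute {n : ℕ} {i j : Fin (n - 1)} (h : i.1 + 1 < j.1 ∨ j.1 + 1 < i.1) :
    Commute (T i) (T j : Module.End Qqt (Poly n)) :=
  h.elim (fun h => T_comm h) fun h => (T_comm h).symm

theorem commute_tailT {n : ℕ} (i : Fin (n - 1)) {k : ℕ} (h : i.1 + 1 < k) :
    Commute (T i) (tailT n k) := by
  unfold tailT
  refine Commute.list_prod_right _ _ fun x hx => ?_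
  simp only [List.mem_map, List.mem_reverse, List.mem_filter, decide_eq_true_eq] at hx
  obtain ⟨j, ⟨-, hj⟩, rfl⟩ := hx
  exact T_commute (Or.inl (by omega))

/-- `T_i` slides through the descending product: it commutes with the factors of index below `i -
1`, a braid relation at the factors `T_i T_{i-1}` turns it into `T_{i-1}`, and that commutes with
the factors of index above `i`. -/
theorem tailT_mul_T {n : ℕ} {i j : Fin (n - 1)} (h : j.1 + 1 = i.1) {k : ℕ} (hk : k ≤ j.1) :
    tailT n k * T i = T j * tailT n k := by
  induction hk using Nat.decreasingInduction with
  | self =>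
    have hc := (commute_tailT (n := n) j (k := i.1 + 1) (by omega)).eq
    rw [tailT_step j, h, tailT_step i, mul_assoc _ (T j), mul_assoc, ← mul_assoc (T i),
      ← T_braid h, ← mul_assoc, ← mul_assoc, ← mul_assoc, ← mul_assoc, hc]
  | of_succ k hk ih =>
    have h1 : k < n - 1 := by have := j.2; omega
    have s1 := tailT_step (⟨k, h1⟩ : Fin (n - 1))
    have hc := (T_commute (n := n) (i := ⟨k, h1⟩) (j := i)
      (Or.inl (by simp only []; omega))).eq
    simp only [] at s1
    rw [s1, mul_assoc, hc, ← mul_assoc, ih, mul_assoc]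

/-- The descending product lowers the index of `T_i` by one and `g` raises it again. -/
theorem commute_Y_zero {n : ℕ} (i : Fin (n - 1)) (h : 0 < i.1) :
    Commute (T i) (Y (⟨0, by have := i.2; omega⟩ : Fin n)) := by
  have hj : i.1 - 1 < n - 1 := by have := i.2; omega
  rw [Y_eq, headInv_zero, pow_zero, one_smul, one_mul]
  have e : (⟨i.1 - 1, hj⟩ : Fin (n - 1)).1 + 1 = i.1 := by simp only []; omega
  unfold Commute SemiconjBy
  rw [mul_assoc, tailT_mul_T e (Nat.zero_le _), ← mul_assoc, ← mul_assoc, g_mul_T e]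

theorem commute_inv {n : ℕ} {i : Fin (n - 1)} {A : Module.End Qqt (Poly n)}
    (h : Commute A (T i)) : Commute A (↑(TUnit i)⁻¹ : Module.End Qqt (Poly n)) :=
  Commute.units_inv_right h

/-- The braid relation moves `a` through `b⁻¹ a⁻¹`, where it becomes `b`; this passes `y` and
becomes `a` again on the other side. -/
theorem commute_conj_of_braid {M : Type*} [Monoid M] {a b : Mˣ} {y : M}
    (hab : a * b * a = b * a * b) (hy : Commute (b : M) y) :
    Commute (a : M) (↑b⁻¹ * (↑a⁻¹ * y * ↑a⁻¹) * ↑b⁻¹) := by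
  have e1 : a * b⁻¹ * a⁻¹ = b⁻¹ * a⁻¹ * b := by
    rw [mul_inv_eq_iff_eq_mul, mul_inv_eq_iff_eq_mul]
    simp only [mul_assoc]
    rw [eq_inv_mul_iff_mul_eq, eq_inv_mul_iff_mul_eq]
    simpa only [mul_assoc] using hab
  have e2 : b * a⁻¹ * b⁻¹ = a⁻¹ * b⁻¹ * a := by
    rw [mul_inv_eq_iff_eq_mul, mul_inv_eq_iff_eq_mul]
    simp only [mul_assoc]
    rw [eq_inv_mul_iff_mul_eq, eq_inv_mul_iff_mul_eq]
    simpa only [mul_assoc] using hab.symm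
  have e1' : (a : M) * ↑b⁻¹ * ↑a⁻¹ = ↑b⁻¹ * ↑a⁻¹ * ↑b := by exact_mod_cast congrArg Units.val e1
  have e2' : (b : M) * ↑a⁻¹ * ↑b⁻¹ = ↑a⁻¹ * ↑b⁻¹ * ↑a := by exact_mod_cast congrArg Units.val e2
  calc (a : M) * (↑b⁻¹ * (↑a⁻¹ * y * ↑a⁻¹) * ↑b⁻¹)
      = (↑a * ↑b⁻¹ * ↑a⁻¹) * y * ↑a⁻¹ * ↑b⁻¹ := by simp only [mul_assoc]
    _ = ↑b⁻¹ * ↑a⁻¹ * (↑b * y) * ↑a⁻¹ * ↑b⁻¹ := by rw [e1']; simp only [mul_assoc]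
    _ = ↑b⁻¹ * ↑a⁻¹ * y * (↑b * ↑a⁻¹ * ↑b⁻¹) := by rw [hy.eq]; simp only [mul_assoc]
    _ = ↑b⁻¹ * (↑a⁻¹ * y * ↑a⁻¹) * ↑b⁻¹ * ↑a := by rw [e2']; simp only [mul_assoc]

/-- Induction on the position through `Y_{i+1} = t T_i⁻¹ Y_i T_i⁻¹`. If the new conjugating operator
is adjacent to `T_i`, the recursion is unfolded twice and `commute_conj_of_braid` applies; otherwise
all factors commute with `T_i`. -/
theorem commute_Y {n : ℕ} (i : Fin (n - 1)) (j : Fin n) (h₁ : j ≠ lo i) (h₂ : j ≠ hi i) :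
    Commute (T i) (Y j) := by
  obtain ⟨k, hk⟩ := j
  induction k using Nat.strong_induction_on generalizing i with
  | _ k ih =>
  simp only [lo, hi, Fin.ext_iff, ne_eq] at h₁ h₂ ih
  rcases k with _ | k
  · exact commute_Y_zero i (by omega)
  have hk1 : k < n - 1 := by omega
  set l : Fin (n - 1) := ⟨k, hk1⟩ with hl
  have e : (⟨k + 1, hk⟩ : Fin n) = hi l := rfl
  rw [e, Y_hi]
  refine Commute.smul_right ?_ t
  by_cases h : i.1 + 1 = k
  · have hlo : lo l = hi i := Fin.ext h.symm
    have hu : TUnit i * TUnit l * TUnit i = TUnit l * TUnit i * TUnit l :=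
      Units.ext (T_braid h)
    have hc : Commute (T l) (Y (lo i)) :=
      ih i.1 (by omega) l (by omega) (by simp only [hl]; omega) (by simp only [hl]; omega)
    rw [hlo, Y_hi, mul_smul_comm, smul_mul_assoc]
    exact (commute_conj_of_braid hu hc).smul_right t
  · have hc : Commute (T i) (T l : Module.End Qqt (Poly n)) :=
      T_commute (by simp only [hl]; omega)
    have hY : Commute (T i) (Y (lo l)) :=
      ih k (by omega) i (by omega) (by omega) (by omega)
    exact ((commute_inv hc).mul_right hY).mul_right (commute_inv hc)

/-- The operator `x_1 g`. -/
def raiseOp (m : ℕ) : Module.End Qqt (Poly (m + 1)) := mulX 0 * (g (m + 1)).toLinearMap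

/-- Only the leading factor `T_{n-1}` has to pass both copies of `g`, becoming `T_1`. Each remaining
factor passes one copy and has its index raised by one. -/
theorem g_mul_g_mul_tailT {n : ℕ} {z : Fin (n - 1)} (hz : z.1 = 0) {k : ℕ} (hk : k ≤ n - 2) :
    (g n).toLinearMap * (g n).toLinearMap * tailT n k =
      T z * ((g n).toLinearMap * tailT n (k + 1) * (g n).toLinearMap) := by
  have := z.2
  induction hk using Nat.decreasingInduction with
  | self =>
    rw [tailT_of_le (k := n - 2 + 1) (by omega),
      show n - 2 = (⟨n - 2, by omega⟩ : Fin (n - 1)).1 from rfl, tailT_step,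
      tailT_of_le (by simp only []; omega), one_mul, mul_one, g_mul_g_mul_T _ hz]
    simp only []; omega
  | of_succ k hk ih =>
    have h1 : k < n - 1 := by omega
    have h2 : k + 1 < n - 1 := by omega
    have s1 := tailT_step (⟨k, h1⟩ : Fin (n - 1))
    have s2 := tailT_step (⟨k + 1, h2⟩ : Fin (n - 1))
    have gs := g_mul_T (n := n) (i := ⟨k, h1⟩) (j := ⟨k + 1, h2⟩) rfl
    simp only [] at s1 s2
    rw [s1, ← mul_assoc, ih, mul_assoc, mul_assoc, gs, s2]
    simp only [mul_assoc]

/-- Each `T_i` moves the variable one place to the right at the cost of `t T_i⁻¹`. The inverses that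
arise extend `headInv`. -/
theorem tailT_mul_mulX {n : ℕ} (k : ℕ) (hk : k < n) :
    tailT n k * mulX ⟨k, hk⟩ * headInv n k =
      t ^ (n - 1 - k) • (mulX ⟨n - 1, by omega⟩ * headInv n (n - 1)) := by
  have hk' : k ≤ n - 1 := by omega
  induction hk' using Nat.decreasingInduction with
  | self => simp [tailT_of_le]
  | of_succ k hk2 ih =>
    have h1 : k < n - 1 := by omega
    have s1 := tailT_step (⟨k, h1⟩ : Fin (n - 1))
    have s2 := headInv_step (⟨k, h1⟩ : Fin (n - 1))
    have s3 := T_mul_mulX (⟨k, h1⟩ : Fin (n - 1))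
    simp only [lo, hi] at s1 s2 s3
    rw [s1, mul_assoc (tailT n (k + 1)), s3]
    rw [mul_smul_comm, smul_mul_assoc, ← mul_assoc, mul_assoc _ _ (headInv n k), ← s2,
      ih (by omega), smul_smul, ← pow_succ']
    congr 2
    omega

theorem g_mul_mulX_of_lt {n : ℕ} (j : Fin n) (h : j.1 + 1 < n) :
    (g n).toLinearMap * mulX j = mulX ⟨j.1 + 1, h⟩ * (g n).toLinearMap := by
  refine LinearMap.ext fun f => ?_
  simp [mulX_apply, g_X_of_lt j h]

theorem g_mul_mulX_last {n : ℕ} (j : Fin n) (h : j.1 + 1 = n) :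
    (g n).toLinearMap * mulX j = q⁻¹ • (mulX ⟨0, j.pos⟩ * (g n).toLinearMap) := by
  refine LinearMap.ext fun f => ?_
  simp [mulX_apply, g_X_last j h, smul_eq_C_mul, mul_assoc]

/-- The product `T_{n-1} ⋯ T_1` carries `x_1` to `x_n` and leaves behind the inverses that occur in
`Y_n`; then `g` brings `x_n` back to `q⁻¹ x_1`. -/
theorem Y_zero_mul_raiseOp (m : ℕ) :
    Y (0 : Fin (m + 1)) * raiseOp m = q⁻¹ • (raiseOp m * Y (Fin.last m)) := by
  have h1 : tailT (m + 1) 0 * mulX 0 = t ^ m • (mulX (Fin.last m) * headInv (m + 1) m) := by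
    have h := tailT_mul_mulX (n := m + 1) 0 (by omega)
    rw [headInv_zero, mul_one] at h
    exact h
  have h2 : (g (m + 1)).toLinearMap * mulX (Fin.last m) = q⁻¹ • (mulX 0 * (g (m + 1)).toLinearMap) :=
    g_mul_mulX_last (Fin.last m) rfl
  rw [Y_eq, Y_eq, tailT_of_le (k := (Fin.last m).1) (by simp), raiseOp]
  simp only [Fin.val_zero, headInv_zero, pow_zero, one_smul, one_mul, mul_one, Fin.val_last]
  calc _ = (g (m + 1)).toLinearMap * (tailT (m + 1) 0 * mulX 0) * (g (m + 1)).toLinearMap := by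
        simp only [mul_assoc]
    _ = t ^ m • (((g (m + 1)).toLinearMap * mulX (Fin.last m)) * headInv (m + 1) m *
        (g (m + 1)).toLinearMap) := by
        rw [h1, mul_smul_comm, smul_mul_assoc]; simp only [mul_assoc]
    _ = _ := by
        rw [h2, smul_mul_assoc, smul_mul_assoc, smul_comm, mul_smul_comm]; simp only [mul_assoc]

theorem mulX_lo_mul_T {n : ℕ} (i : Fin (n - 1)) :
    t • ((↑(TUnit i)⁻¹ : Module.End Qqt (Poly n)) * mulX (hi i)) = mulX (lo i) * T i := by
  have h := T_mul_mulX i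
  calc _ = (↑(TUnit i)⁻¹ : Module.End Qqt (Poly n)) *
        (t • (mulX (hi i) * (↑(TUnit i)⁻¹ : Module.End Qqt (Poly n)))) * T i := by
        rw [mul_smul_comm, smul_mul_assoc, mul_assoc, mul_assoc _ _ (T i), inv_mul_T, mul_one]
    _ = _ := by rw [← h, ← mul_assoc, inv_mul_T, one_mul]

theorem commute_mulX_tailT {n : ℕ} {j : Fin n} {k : ℕ} (h : j.1 < k) :
    Commute (mulX j) (tailT n k) := by
  unfold tailT
  refine Commute.list_prod_right _ _ fun x hx => ?_
  simp only [List.mem_map, List.mem_reverse, List.mem_filter, decide_eq_true_eq] at hx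
  obtain ⟨l, ⟨-, hl⟩, rfl⟩ := hx
  refine (T_mul_mulX_of_ne l ?_ ?_).symm
  · simp only [lo, ne_eq, Fin.ext_iff]; omega
  · simp only [hi, ne_eq, Fin.ext_iff]; omega

theorem T_mul_raiseOp {m : ℕ} {i j : Fin (m + 1 - 1)} (h : i.1 + 1 = j.1) :
    T j * raiseOp m = raiseOp m * T i := by
  rw [raiseOp, ← mul_assoc, T_mul_mulX_of_ne, mul_assoc, mul_assoc, g_mul_T h]
  · simp only [lo, ne_eq, Fin.ext_iff, Fin.val_zero]; omega
  · simp only [hi, ne_eq, Fin.ext_iff, Fin.val_zero]; omega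

/-- The base case `Y_2 Φ = Φ Y_1` rests on `t T_1⁻¹ x_2 = x_1 T_1` and on moving `T_1` through `g²`.
The other cases follow by conjugation, because `T_{i+1} Φ = Φ T_i`. -/
theorem Y_hi_mul_raiseOp {m : ℕ} (i : Fin (m + 1 - 1)) :
    Y (hi i) * raiseOp m = raiseOp m * Y (lo i) := by
  obtain ⟨k, hk⟩ := i
  induction k with
  | zero =>
    set z : Fin (m + 1 - 1) := ⟨0, hk⟩ with hz
    have s1 := headInv_step z
    have s2 := mulX_lo_mul_T z
    have s3 := g_mul_g_mul_tailT (n := m + 1) (z := z) rfl (Nat.zero_le _)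
    have s4 := (commute_mulX_tailT (n := m + 1) (j := 0) (k := 1) (by simp)).eq
    have s5 := g_mul_mulX_of_lt (lo z) (by simp only [lo, hz]; omega)
    have e1 : lo z = 0 := rfl
    have e2 : (⟨(lo z).1 + 1, by simp only [lo, hz]; omega⟩ : Fin (m + 1)) = hi z := rfl
    have e3 : z.1 = 0 := rfl
    simp only [e3, headInv_zero, mul_one] at s1
    rw [e2] at s5
    rw [Y_eq, Y_eq, e1]
    rw [e1] at s2 s5
    simp only [hi, e3, Fin.val_zero, zero_add, headInv_zero, pow_one, pow_zero, one_smul, one_mul]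
      at s1 ⊢
    rw [s1, raiseOp]
    calc _ = t • (↑(TUnit z)⁻¹ * ((g (m + 1)).toLinearMap * (tailT (m + 1) 1 * mulX 0) *
          (g (m + 1)).toLinearMap)) := by
          rw [smul_mul_assoc]; simp only [mul_assoc]
      _ = (t • (↑(TUnit z)⁻¹ * mulX (hi z))) * ((g (m + 1)).toLinearMap * tailT (m + 1) 1 *
          (g (m + 1)).toLinearMap) := by
          rw [← s4, ← mul_assoc (g (m + 1)).toLinearMap, s5, smul_mul_assoc]; simp only [mul_assoc]
      _ = _ := by rw [s2, mul_assoc, ← s3]; simp only [mul_assoc]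
  | succ k ih =>
    have hk1 : k < m + 1 - 1 := by omega
    set l : Fin (m + 1 - 1) := ⟨k, hk1⟩ with hl
    set j : Fin (m + 1 - 1) := ⟨k + 1, hk⟩ with hj
    have hlj : l.1 + 1 = j.1 := rfl
    have e : lo j = hi l := rfl
    have h1 := T_mul_raiseOp hlj
    have h2 : (↑(TUnit j)⁻¹ : Module.End Qqt _) * raiseOp m =
        raiseOp m * (↑(TUnit l)⁻¹ : Module.End Qqt _) := by
      rw [coe_inv_TUnit, coe_inv_TUnit, smul_mul_assoc, add_mul, h1, mul_smul_comm, mul_add,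
        smul_mul_assoc, mul_smul_comm, one_mul, mul_one]
    rw [Y_hi j, e, smul_mul_assoc, mul_assoc, h2, mul_assoc, ← mul_assoc (Y (hi l)),
      ih hk1, ← mul_assoc, ← mul_assoc, h2, Y_hi l, mul_smul_comm]
    simp only [mul_assoc]
    rfl

/-! ### Rational functions without a pole at `q = 0` -/

theorem regularAtZero_of_dvd {c : Qqt} {p : Polynomial Qt} (h : c.denom ∣ p)
    (hp : p.eval 0 ≠ 0) : RegularAtZero c := by
  obtain ⟨r, rfl⟩ := h
  rw [Polynomial.eval_mul] at hp
  exact left_ne_zero_of_mul hp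

/-- The subring of `ℚ(t)(q)` of the rational functions without a pole at `q = 0`. -/
def regularSubring : Subring Qqt where
  carrier := {c | RegularAtZero c}
  mul_mem' {a b} ha hb := regularAtZero_of_dvd (RatFunc.denom_mul_dvd a b) <| by
    rw [Polynomial.eval_mul]; exact mul_ne_zero ha hb
  one_mem' := by simp [RegularAtZero]
  add_mem' {a b} ha hb := regularAtZero_of_dvd (RatFunc.denom_add_dvd a b) <| by
    rw [Polynomial.eval_mul]; exact mul_ne_zero ha hb
  zero_mem' := by simp [RegularAtZero]
  neg_mem' {a} ha := by
    have h : RegularAtZero (RatFunc.C (-1) * a) :=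
      regularAtZero_of_dvd (RatFunc.denom_mul_dvd _ a) <| by
        rw [Polynomial.eval_mul]
        exact mul_ne_zero (by rw [RatFunc.denom_C]; simp) ha
    simpa using h

theorem mem_regularSubring {c : Qqt} : c ∈ regularSubring ↔ RegularAtZero c := Iff.rfl

theorem C_mem_regularSubring (c : Qt) : RatFunc.C c ∈ regularSubring := by
  rw [mem_regularSubring, RegularAtZero, RatFunc.denom_C]
  simp

theorem t_mem : t ∈ regularSubring := C_mem_regularSubring _

theorem t_inv_mem : t⁻¹ ∈ regularSubring := by
  rw [t, ← map_inv₀]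
  exact C_mem_regularSubring _

theorem q_mem : q ∈ regularSubring := by
  rw [mem_regularSubring, RegularAtZero, q, RatFunc.denom_X]
  simp

theorem inv_algebraMap_mem {p : Polynomial Qt} (hp : p.eval 0 ≠ 0) :
    (algebraMap (Polynomial Qt) Qqt p)⁻¹ ∈ regularSubring := by
  have h := RatFunc.denom_div_dvd (1 : Polynomial Qt) p
  rw [map_one, one_div] at h
  exact regularAtZero_of_dvd h hp

/-- `RatFunc.eval` respects sums and products only where the denominators do not vanish, hence the
regularity hypotheses. -/
theorem evalZero_eq_of_sub {a b d : Qqt} (hb : b ∈ regularSubring) (hd : d ∈ regularSubring)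
    (h : a = b + q * d) : evalZero a = evalZero b := by
  have hq : Polynomial.eval₂ (RingHom.id Qt) 0 q.denom ≠ 0 := q_mem
  have hd' : Polynomial.eval₂ (RingHom.id Qt) 0 d.denom ≠ 0 := hd
  have hb' : Polynomial.eval₂ (RingHom.id Qt) 0 b.denom ≠ 0 := hb
  have hqd : Polynomial.eval₂ (RingHom.id Qt) 0 (q * d).denom ≠ 0 :=
    regularSubring.mul_mem q_mem hd
  rw [h, evalZero, RatFunc.eval_add _ _ hb' hqd, RatFunc.eval_mul _ _ hq hd', q, RatFunc.eval_X,
    zero_mul, add_zero]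
  rfl

/-- The subring of the polynomials all of whose coefficients have no pole at `q = 0`. -/
def regularPoly (n : ℕ) : Subring (Poly n) where
  carrier := {f | ∀ m, coeff m f ∈ regularSubring}
  mul_mem' {a b} ha hb m := by
    rw [coeff_mul]
    exact sum_mem fun x _ => mul_mem (ha _) (hb _)
  one_mem' m := by
    rw [coeff_one]
    split_ifs
    exacts [one_mem _, zero_mem _]
  add_mem' {a b} ha hb m := by
    rw [coeff_add]
    exact add_mem (ha m) (hb m)
  zero_mem' m := by
    rw [coeff_zero]
    exact zero_mem _
  neg_mem' {a} ha m := by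
    rw [coeff_neg]
    exact neg_mem (ha m)

theorem smul_mem_regularPoly {n : ℕ} {c : Qqt} {f : Poly n} (hc : c ∈ regularSubring)
    (hf : f ∈ regularPoly n) : c • f ∈ regularPoly n := fun m => by
  rw [coeff_smul, smul_eq_mul]
  exact mul_mem hc (hf m)

theorem monomial_mem_regularPoly {n : ℕ} (m : Fin n →₀ ℕ) {c : Qqt} (hc : c ∈ regularSubring) :
    monomial m c ∈ regularPoly n := fun m' => by
  rw [coeff_monomial]
  split_ifs
  exacts [hc, zero_mem _]

/-- Congruence modulo `q` of polynomials without poles at `q = 0`. -/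
def CongrModQ {n : ℕ} (f g : Poly n) : Prop := ∃ h ∈ regularPoly n, f = g + q • h

theorem CongrModQ.refl {n : ℕ} (f : Poly n) : CongrModQ f f :=
  ⟨0, zero_mem _, by simp⟩

theorem CongrModQ.trans {n : ℕ} {f g h : Poly n} (h₁ : CongrModQ f g) (h₂ : CongrModQ g h) :
    CongrModQ f h := by
  obtain ⟨a, ha, rfl⟩ := h₁
  obtain ⟨b, hb, rfl⟩ := h₂
  exact ⟨b + a, add_mem hb ha, by rw [smul_add, add_assoc]⟩

theorem CongrModQ.symm {n : ℕ} {f g : Poly n} (h : CongrModQ f g) : CongrModQ g f := by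
  obtain ⟨a, ha, rfl⟩ := h
  exact ⟨-a, neg_mem ha, by rw [smul_neg, add_neg_cancel_right]⟩

theorem CongrModQ.smul {n : ℕ} {f g : Poly n} {c : Qqt} (hc : c ∈ regularSubring)
    (h : CongrModQ f g) : CongrModQ (c • f) (c • g) := by
  obtain ⟨a, ha, rfl⟩ := h
  exact ⟨c • a, smul_mem_regularPoly hc ha, by rw [smul_add, smul_comm c q]⟩

theorem CongrModQ.specialize_eq {n : ℕ} {f g : Poly n} (hg : g ∈ regularPoly n)
    (h : CongrModQ f g) : specialize f = specialize g := by
  have key : ∀ (p : Poly n) (m : Fin n →₀ ℕ), coeff m (specialize p) = evalZero (coeff m p) := by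
    intro p m
    rw [specialize, coeff_sum]
    simp only [coeff_monomial]
    rw [Finset.sum_ite_eq' p.support m]
    split_ifs with hm
    · rfl
    · rw [notMem_support_iff.mp hm, evalZero, RatFunc.eval_zero]
  obtain ⟨a, ha, rfl⟩ := h
  ext m
  rw [key, key]
  refine evalZero_eq_of_sub (hg m) (ha m) ?_
  rw [coeff_add, coeff_smul, smul_eq_mul]

/-! ### The Demazure–Lusztig operators on monomials -/

theorem T_X_lo_pow {n : ℕ} (i : Fin (n - 1)) (k : ℕ) :
    T i (X (lo i) ^ k : Poly n) = t • X (hi i) ^ k +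
      (1 - t) • ∑ j ∈ Finset.range k, X (lo i) ^ j * X (hi i) ^ (k - j) := by
  have hs : (X (hi i) : Poly n) * ∑ j ∈ Finset.range k, X (lo i) ^ j * X (hi i) ^ (k - 1 - j) =
      ∑ j ∈ Finset.range k, X (lo i) ^ j * X (hi i) ^ (k - j) := by
    rw [Finset.mul_sum]
    refine Finset.sum_congr rfl fun j hj => ?_
    have : k - j = k - 1 - j + 1 := by have := Finset.mem_range.mp hj; omega
    rw [this, pow_succ']
    ring
  have h := geom_sum₂_mul (X (lo i) : Poly n) (X (hi i)) k
  apply T_unique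
  rw [map_pow, sAct_X, simple_lo, ← hs]
  simp only [smul_eq_C_mul, map_sub, map_one]
  linear_combination (1 - C t) * X (hi i) * h

theorem T_X_hi_pow {n : ℕ} (i : Fin (n - 1)) (k : ℕ) :
    T i (X (hi i) ^ k : Poly n) = t • X (lo i) ^ k -
      (1 - t) • ∑ j ∈ Finset.range k, X (lo i) ^ j * X (hi i) ^ (k - j) := by
  have hs : sAct i (X (lo i) ^ k : Poly n) = X (hi i) ^ k := by
    rw [map_pow, sAct_X, simple_lo]
  have hs' : sAct i (X (hi i) ^ k : Poly n) = X (lo i) ^ k := by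
    rw [map_pow, sAct_X, simple_hi]
  have h1 := sub_mul_T i (X (lo i) ^ k : Poly n)
  apply T_unique
  rw [T_X_lo_pow, hs] at h1
  rw [hs']
  simp only [smul_eq_C_mul, map_sub, map_one] at h1 ⊢
  linear_combination -h1

theorem monomial_mul_pow_mul_pow {n : ℕ} (m : Fin n →₀ ℕ) (a b : Fin n) (j k : ℕ) :
    (monomial m 1 * (X a ^ j * X b ^ k) : Poly n) =
      monomial (m + Finsupp.single a j + Finsupp.single b k) 1 := by
  rw [X_pow_eq_monomial, X_pow_eq_monomial, monomial_mul, monomial_mul, one_mul, one_mul,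
    add_assoc]

theorem sAct_monomial {n : ℕ} {i : Fin (n - 1)} {m : Fin n →₀ ℕ} (h : m (lo i) = m (hi i))
    (c : Qqt) : sAct i (monomial m c) = monomial m c := by
  rw [sAct, rename_monomial]
  suffices Finsupp.mapDomain (simple i) m = m by rw [this]
  refine Finsupp.ext fun j => ?_
  rw [← Finsupp.equivMapDomain_eq_mapDomain, Finsupp.equivMapDomain_apply]
  change m ((simple i)⁻¹ j) = m j
  rw [simple_inv]
  rcases eq_or_ne j (lo i) with rfl | h1
  · rw [simple_lo, h]
  rcases eq_or_ne j (hi i) with rfl | h2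
  · rw [simple_hi, h]
  rw [simple_of_ne i h1 h2]

theorem T_monomial_lo {n : ℕ} {i : Fin (n - 1)} {m : Fin n →₀ ℕ} (h : m (lo i) = m (hi i))
    (k : ℕ) : T i (monomial (m + Finsupp.single (lo i) k) 1) =
      t • monomial (m + Finsupp.single (hi i) k) 1 + (1 - t) • ∑ j ∈ Finset.range k,
        monomial (m + Finsupp.single (lo i) j + Finsupp.single (hi i) (k - j)) 1 := by
  have e1 := monomial_mul_pow_mul_pow m (lo i) (hi i) k 0
  have e2 := monomial_mul_pow_mul_pow m (lo i) (hi i) 0 k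
  simp only [pow_zero, mul_one, one_mul, Finsupp.single_zero, add_zero] at e1 e2
  rw [← e1, T_mul_of_invariant i (sAct_monomial h 1), T_X_lo_pow, mul_add, mul_smul_comm,
    mul_smul_comm, e2, Finset.mul_sum]
  simp only [monomial_mul_pow_mul_pow]

theorem T_monomial_hi {n : ℕ} {i : Fin (n - 1)} {m : Fin n →₀ ℕ} (h : m (lo i) = m (hi i))
    (k : ℕ) : T i (monomial (m + Finsupp.single (hi i) k) 1) =
      t • monomial (m + Finsupp.single (lo i) k) 1 - (1 - t) • ∑ j ∈ Finset.range k,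
        monomial (m + Finsupp.single (lo i) j + Finsupp.single (hi i) (k - j)) 1 := by
  have e1 := monomial_mul_pow_mul_pow m (lo i) (hi i) k 0
  have e2 := monomial_mul_pow_mul_pow m (lo i) (hi i) 0 k
  simp only [pow_zero, mul_one, one_mul, Finsupp.single_zero, add_zero] at e1 e2
  rw [← e2, T_mul_of_invariant i (sAct_monomial h 1), T_X_hi_pow, mul_sub, mul_smul_comm,
    mul_smul_comm, e1, Finset.mul_sum]
  simp only [monomial_mul_pow_mul_pow]

/-- `γ` lies between `β` and `s_i · β` on the line that joins them. -/
def Hull {n : ℕ} (i : Fin (n - 1)) (β γ : Fin n → ℕ) : Prop :=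
  (∀ j, j ≠ lo i → j ≠ hi i → γ j = β j) ∧ γ (lo i) + γ (hi i) = β (lo i) + β (hi i) ∧
    γ (lo i) ≤ max (β (lo i)) (β (hi i)) ∧ γ (hi i) ≤ max (β (lo i)) (β (hi i))

/-- Every monomial is an `s_i`-invariant monomial times a power of one of the two variables. Since
`T_i` is linear over invariants, only such powers have to be computed. -/
theorem exists_eq_add_single {n : ℕ} (i : Fin (n - 1)) (m : Fin n →₀ ℕ) :
    ∃ (m₀ : Fin n →₀ ℕ) (k : ℕ), m₀ (lo i) = m₀ (hi i) ∧
      ((m (hi i) ≤ m (lo i) ∧ m = m₀ + Finsupp.single (lo i) k) ∨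
        (m (lo i) < m (hi i) ∧ m = m₀ + Finsupp.single (hi i) k)) := by
  have hne := lo_ne_hi i
  rcases le_or_gt (m (hi i)) (m (lo i)) with h | h
  · refine ⟨m - Finsupp.single (lo i) (m (lo i) - m (hi i)), m (lo i) - m (hi i), ?_,
      Or.inl ⟨h, ?_⟩⟩
    · simp [hne]; omega
    · rw [tsub_add_cancel_of_le]
      rw [Finsupp.single_le_iff]; omega
  · refine ⟨m - Finsupp.single (hi i) (m (hi i) - m (lo i)), m (hi i) - m (lo i), ?_,
      Or.inr ⟨h, ?_⟩⟩
    · simp [hne.symm]; omega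
    · rw [tsub_add_cancel_of_le]
      rw [Finsupp.single_le_iff]; omega

theorem hull_add_single {n : ℕ} {i : Fin (n - 1)} {m : Fin n →₀ ℕ} (h : m (lo i) = m (hi i))
    {j k : ℕ} (hj : j ≤ k) :
    Hull i ⇑(m + Finsupp.single (lo i) k)
        ⇑(m + Finsupp.single (lo i) j + Finsupp.single (hi i) (k - j)) ∧
      Hull i ⇑(m + Finsupp.single (hi i) k)
        ⇑(m + Finsupp.single (lo i) j + Finsupp.single (hi i) (k - j)) := by
  have hne := lo_ne_hi i
  refine ⟨⟨fun l h1 h2 => ?_, ?_, ?_, ?_⟩, ⟨fun l h1 h2 => ?_, ?_, ?_, ?_⟩⟩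
  · simp [h1, h2]
  · simp [hne, hne.symm]; omega
  · simp [hne]; omega
  · simp [hne.symm]; omega
  · simp [h1, h2]
  · simp [hne, hne.symm]; omega
  · simp [hne]; omega
  · simp [hne.symm]

theorem T_monomial_regular_hull {n : ℕ} (i : Fin (n - 1)) (m : Fin n →₀ ℕ) :
    T i (monomial m 1) ∈ regularPoly n ∧
      ∀ m', coeff m' (T i (monomial m 1 : Poly n)) ≠ 0 → Hull i m m' := by
  have mono : ∀ m : Fin n →₀ ℕ, (monomial m 1 : Poly n) ∈ regularPoly n := fun m =>
    monomial_mem_regularPoly m (one_mem _)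
  have h1t : 1 - t ∈ regularSubring := sub_mem (one_mem _) t_mem
  obtain ⟨m₀, k, h₀, ⟨-, rfl⟩ | ⟨-, rfl⟩⟩ := exists_eq_add_single i m
  · rw [T_monomial_lo h₀]
    refine ⟨add_mem (smul_mem_regularPoly t_mem (mono _))
      (smul_mem_regularPoly h1t (sum_mem fun j _ => mono _)), fun m' h => ?_⟩
    by_contra hH
    apply h
    simp only [coeff_add, coeff_smul, coeff_sum, coeff_monomial]
    rw [if_neg, Finset.sum_eq_zero, smul_zero, smul_zero, add_zero]
    · intro j hj
      rw [if_neg]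
      rintro rfl
      exact hH (hull_add_single h₀ (Finset.mem_range.mp hj).le).1
    · rintro rfl
      have := (hull_add_single h₀ (Nat.zero_le k)).1
      rw [Finsupp.single_zero, add_zero] at this
      exact hH this
  · rw [T_monomial_hi h₀]
    refine ⟨sub_mem (smul_mem_regularPoly t_mem (mono _))
      (smul_mem_regularPoly h1t (sum_mem fun j _ => mono _)), fun m' h => ?_⟩
    by_contra hH
    apply h
    simp only [coeff_sub, coeff_smul, coeff_sum, coeff_monomial]
    rw [if_neg, Finset.sum_eq_zero, smul_zero, smul_zero, sub_zero]
    · intro j hj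
      rw [if_neg]
      rintro rfl
      exact hH (hull_add_single h₀ (Finset.mem_range.mp hj).le).2
    · rintro rfl
      have := (hull_add_single h₀ (le_refl k)).2
      rw [tsub_self, Finsupp.single_zero, add_zero] at this
      exact hH this

/-- The reflected monomial receives `t` from `t s_i` and `1 - t` from the end of the geometric sum.
The total is `1`, so the recursion needs no renormalization. -/
theorem coeff_T_monomial {n : ℕ} {i : Fin (n - 1)} {m m' : Fin n →₀ ℕ}
    (h : m (hi i) < m (lo i)) (hm' : ∀ j, m' j = m (simple i j)) :
    coeff m' (T i (monomial m 1 : Poly n)) = 1 := by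
  have hne := lo_ne_hi i
  obtain ⟨m₀, k, h₀, ⟨-, rfl⟩ | ⟨h', -⟩⟩ := exists_eq_add_single i m
  · have hk : 0 < k := by
      simp [hne] at h; omega
    have e : m' = m₀ + Finsupp.single (hi i) k := by
      ext j
      rw [hm']
      rcases eq_or_ne j (lo i) with rfl | h1
      · simp [simple_lo, hne, hne.symm, h₀]
      rcases eq_or_ne j (hi i) with rfl | h2
      · simp [simple_hi, h₀]
      simp [simple_of_ne i h1 h2, h1.symm, h2.symm]
    obtain ⟨k, rfl⟩ := Nat.exists_eq_succ_of_ne_zero hk.ne'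
    rw [T_monomial_lo h₀, e, Finset.sum_range_succ']
    simp only [coeff_add, coeff_smul, coeff_sum, coeff_monomial]
    rw [Finset.sum_eq_zero]
    · simp
    · intro j _
      rw [if_neg]
      intro he
      have := DFunLike.congr_fun he (lo i)
      simp [hne] at this
  · omega

theorem T_monomial_smul {n : ℕ} (i : Fin (n - 1)) (f : Poly n) :
    T i f = ∑ m ∈ f.support, coeff m f • T i (monomial m 1) := by
  conv_lhs => rw [f.as_sum, map_sum]
  refine Finset.sum_congr rfl fun m _ => ?_
  rw [← map_smul, smul_monomial, smul_eq_mul, mul_one]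

theorem T_mem_regularPoly {n : ℕ} (i : Fin (n - 1)) {f : Poly n} (hf : f ∈ regularPoly n) :
    T i f ∈ regularPoly n := by
  rw [T_monomial_smul]
  exact sum_mem fun m _ => smul_mem_regularPoly (hf m) (T_monomial_regular_hull i m).1

theorem exists_hull_of_mem_support_T {n : ℕ} {i : Fin (n - 1)} {f : Poly n} {m' : Fin n →₀ ℕ}
    (h : m' ∈ (T i f).support) : ∃ m ∈ f.support, Hull i m m' := by
  rw [mem_support_iff, T_monomial_smul, coeff_sum] at h
  obtain ⟨m, hm, hne⟩ := Finset.exists_ne_zero_of_sum_ne_zero h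
  rw [coeff_smul, smul_eq_mul] at hne
  exact ⟨m, hm, (T_monomial_regular_hull i m).2 m' (right_ne_zero_of_mul hne)⟩

theorem CongrModQ.map_T {n : ℕ} (i : Fin (n - 1)) {f g : Poly n} (h : CongrModQ f g) :
    CongrModQ (T i f) (T i g) := by
  obtain ⟨a, ha, rfl⟩ := h
  exact ⟨T i a, T_mem_regularPoly i ha, by rw [map_add, map_smul]⟩

/-! ### The order on compositions -/

/-- The number of boxes above level `l` in the diagram of a composition whose columns from
position `r` on are lifted by one. -/
def levelSum {n : ℕ} (α : Fin n → ℕ) (l r : ℕ) : ℕ :=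
  ∑ j, (α j + (if r ≤ j.1 then 1 else 0) - l)

/-- The Bruhat order on compositions, defined by comparing the numbers `levelSum`. -/
def BelowEq {n : ℕ} (β α : Fin n → ℕ) : Prop :=
  ∀ l r, r ≤ n → levelSum β l r ≤ levelSum α l r

theorem BelowEq.refl {n : ℕ} (α : Fin n → ℕ) : BelowEq α α := fun _ _ _ => le_rfl

theorem BelowEq.trans {n : ℕ} {α β γ : Fin n → ℕ} (h₁ : BelowEq α β) (h₂ : BelowEq β γ) :
    BelowEq α γ := fun l r hr => (h₁ l r hr).trans (h₂ l r hr)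

/-- Consecutive differences in `r` decide whether `l ≤ α_r`, so the level sums determine the
composition. Antisymmetry of the order follows. -/
theorem levelSum_succ {n : ℕ} (α : Fin n → ℕ) (l : ℕ) (r : Fin n) :
    levelSum α l r.1 = levelSum α l (r.1 + 1) + if l ≤ α r then 1 else 0 := by
  have h1 := Finset.add_sum_erase Finset.univ
    (fun j : Fin n => α j + (if r.1 ≤ j.1 then 1 else 0) - l) (Finset.mem_univ r)
  have h2 := Finset.add_sum_erase Finset.univ
    (fun j : Fin n => α j + (if r.1 + 1 ≤ j.1 then 1 else 0) - l) (Finset.mem_univ r)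
  have h3 : ∑ j ∈ Finset.univ.erase r, (α j + (if r.1 ≤ j.1 then 1 else 0) - l) =
      ∑ j ∈ Finset.univ.erase r, (α j + (if r.1 + 1 ≤ j.1 then 1 else 0) - l) := by
    refine Finset.sum_congr rfl fun j hj => ?_
    have : j.1 ≠ r.1 := fun h => Finset.ne_of_mem_erase hj (Fin.ext h)
    have : r.1 ≤ j.1 ↔ r.1 + 1 ≤ j.1 := by omega
    simp only [this]
  simp only [le_refl, if_true, show ¬ r.1 + 1 ≤ r.1 by omega, if_false] at h1 h2
  unfold levelSum
  split_ifs <;> omega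

theorem BelowEq.antisymm {n : ℕ} {α β : Fin n → ℕ} (h₁ : BelowEq α β) (h₂ : BelowEq β α) :
    α = β := by
  have h : ∀ l r, r ≤ n → levelSum α l r = levelSum β l r := fun l r hr =>
    le_antisymm (h₁ l r hr) (h₂ l r hr)
  have key : ∀ (r : Fin n) l, l ≤ α r ↔ l ≤ β r := fun r l => by
    have a1 := levelSum_succ α l r
    have a2 := levelSum_succ β l r
    have a3 := h l r r.2.le
    have a4 := h l (r + 1) r.2
    by_cases c1 : l ≤ α r <;> by_cases c2 : l ≤ β r <;> simp [c1, c2] at a1 a2 ⊢ <;> omega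
  funext r
  exact le_antisymm ((key r _).mp le_rfl) ((key r _).mpr le_rfl)

theorem finite_setOf_belowEq {n : ℕ} (α : Fin n → ℕ) : {β | BelowEq β α}.Finite := by
  refine (Set.finite_Iic (fun _ : Fin n => levelSum α 0 0)).subset fun β hβ j => ?_
  refine le_trans ?_ (hβ 0 0 (Nat.zero_le _))
  have := Finset.single_le_sum (f := fun j : Fin n => β j + (if 0 ≤ j.1 then 1 else 0) - 0)
    (fun _ _ => Nat.zero_le _) (Finset.mem_univ j)
  unfold levelSum
  simp at this ⊢
  omega

/-- The number of compositions below a given one. -/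
def belowCard {n : ℕ} (α : Fin n → ℕ) : ℕ := {β | BelowEq β α}.ncard

theorem belowCard_lt {n : ℕ} {α β : Fin n → ℕ} (h : BelowEq β α) (hne : β ≠ α) :
    belowCard β < belowCard α :=
  Set.ncard_lt_ncard ⟨fun _ hγ => BelowEq.trans hγ h,
    fun hsub => hne (h.antisymm (hsub (BelowEq.refl α)))⟩ (finite_setOf_belowEq α)

theorem sum_split {n : ℕ} (i : Fin (n - 1)) (f : Fin n → ℕ) :
    ∑ j, f j = f (lo i) + f (hi i) + ∑ j ∈ (Finset.univ.erase (lo i)).erase (hi i), f j := by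
  rw [add_assoc, Finset.add_sum_erase _ f, Finset.add_sum_erase _ f (Finset.mem_univ _)]
  exact Finset.mem_erase.mpr ⟨(lo_ne_hi i).symm, Finset.mem_univ _⟩

/-- The part of `levelSum` that comes from the positions other than `i` and `i + 1`. -/
def restSum {n : ℕ} (i : Fin (n - 1)) (α : Fin n → ℕ) (l r : ℕ) : ℕ :=
  ∑ j ∈ (Finset.univ.erase (lo i)).erase (hi i), (α j + (if r ≤ j.1 then 1 else 0) - l)

theorem levelSum_split {n : ℕ} (i : Fin (n - 1)) (α : Fin n → ℕ) (l r : ℕ) :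
    levelSum α l r = (α (lo i) + (if r ≤ i.1 then 1 else 0) - l) +
      (α (hi i) + (if r ≤ i.1 + 1 then 1 else 0) - l) + restSum i α l r :=
  sum_split i _

theorem restSum_congr {n : ℕ} {i : Fin (n - 1)} {α β : Fin n → ℕ}
    (h : ∀ j, j ≠ lo i → j ≠ hi i → β j = α j) (l r : ℕ) : restSum i β l r = restSum i α l r := by
  refine Finset.sum_congr rfl fun j hj => ?_
  rw [Finset.mem_erase, Finset.mem_erase] at hj
  rw [h j hj.2.1 hj.1]

theorem restSum_step {n : ℕ} (i : Fin (n - 1)) (α : Fin n → ℕ) (l : ℕ) :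
    restSum i α l i.1 = restSum i α l (i.1 + 1) ∧
      restSum i α l (i.1 + 2) = restSum i α l (i.1 + 1) := by
  constructor <;>
  · refine Finset.sum_congr rfl fun j hj => ?_
    rw [Finset.mem_erase, Finset.mem_erase] at hj
    have h1 : j.1 ≠ i.1 + 1 := fun h => hj.1 (Fin.ext h)
    have h2 : j.1 ≠ i.1 := fun h => hj.2.1 (Fin.ext h)
    congr 3
    apply propext
    omega

theorem act_simple_lo {n : ℕ} (i : Fin (n - 1)) (α : Fin n → ℕ) :
    (α ∘ simple i) (lo i) = α (hi i) := by
  rw [Function.comp_apply, simple_lo]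

theorem act_simple_hi {n : ℕ} (i : Fin (n - 1)) (α : Fin n → ℕ) :
    (α ∘ simple i) (hi i) = α (lo i) := by
  rw [Function.comp_apply, simple_hi]

theorem act_simple_of_ne {n : ℕ} (i : Fin (n - 1)) (α : Fin n → ℕ) (j : Fin n) (h₁ : j ≠ lo i)
    (h₂ : j ≠ hi i) : (α ∘ simple i) j = α j := by
  rw [Function.comp_apply, simple_of_ne i h₁ h₂]

/-- The truncated difference is convex, so moving two entries towards each other cannot increase the
level sums in which both columns are lifted equally. Lifting only one of the columns is the
remaining case. -/
theorem BelowEq.hull {n : ℕ} {i : Fin (n - 1)} {α β γ : Fin n → ℕ} (h : BelowEq β α)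
    (hα : α (hi i) < α (lo i)) (hγ : Hull i β γ) : BelowEq γ (α ∘ simple i) := by
  obtain ⟨h1, h2, h3, h4⟩ := hγ
  intro l r hr
  have hin : i.1 + 2 ≤ n := by have := i.2; omega
  rw [levelSum_split i, levelSum_split i, act_simple_lo, act_simple_hi,
    restSum_congr (act_simple_of_ne i α), restSum_congr h1]
  rcases eq_or_ne r (i.1 + 1) with rfl | hne
  -- Only column `i + 1` is lifted. The bound comes from lifting both columns if `l > α_{i+1}`, and
  -- from lifting neither, plus one, if `l ≤ α_{i+1}`.
  · have k1 := h l i.1 (by omega)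
    have k2 := h l (i.1 + 2) hin
    rw [levelSum_split i, levelSum_split i, (restSum_step i _ l).1, (restSum_step i _ l).1] at k1
    rw [levelSum_split i, levelSum_split i, (restSum_step i _ l).2, (restSum_step i _ l).2] at k2
    simp only [le_refl, show i.1 ≤ i.1 + 1 by omega, if_true, show ¬ i.1 + 2 ≤ i.1 by omega,
      show ¬ i.1 + 2 ≤ i.1 + 1 by omega, show ¬ i.1 + 1 ≤ i.1 by omega, if_false] at k1 k2 ⊢
    omega
  · have k := h l r hr
    rw [levelSum_split i, levelSum_split i] at k
    have e : r ≤ i.1 + 1 ↔ r ≤ i.1 := by omega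
    simp only [e] at k ⊢
    split_ifs at k ⊢ <;> omega

/-- Ensures that, among the monomials of `E_α`, only `x^α` contributes to the coefficient of `x^{s_i
α}` after `T_i` is applied. -/
theorem BelowEq.eq_of_hull {n : ℕ} {i : Fin (n - 1)} {α β : Fin n → ℕ} (h : BelowEq β α)
    (hα : α (hi i) < α (lo i)) (hβ : Hull i β (α ∘ simple i)) : β = α := by
  obtain ⟨h1, h2, h3, h4⟩ := hβ
  rw [act_simple_lo, act_simple_hi] at h2
  rw [act_simple_lo] at h3
  rw [act_simple_hi] at h4
  have h1' : ∀ j, j ≠ lo i → j ≠ hi i → β j = α j := fun j a b => by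
    rw [← h1 j a b, act_simple_of_ne i α j a b]
  have hin : i.1 + 2 ≤ n := by have := i.2; omega
  -- At this level the right-hand pair vanishes, so both entries of `β` are at most `α_i`; `k2` then
  -- forces the right entry to be strictly smaller, so the left one is the maximum `α_i`.
  have k1 := h (α (lo i) + 1) i.1 (by omega)
  have k2 := h (α (lo i)) (i.1 + 1) (by omega)
  rw [levelSum_split i, levelSum_split i, restSum_congr h1'] at k1 k2
  simp only [le_refl, show i.1 ≤ i.1 + 1 by omega, if_true, show ¬ i.1 + 1 ≤ i.1 by omega,
    if_false] at k1 k2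
  funext j
  rcases eq_or_ne j (lo i) with rfl | hj1
  · omega
  rcases eq_or_ne j (hi i) with rfl | hj2
  · omega
  exact h1' j hj1 hj2

/-- The composition `(α_n + 1, α_1, …, α_{n-1})`. -/
def raise {m : ℕ} (α : Fin (m + 1) → ℕ) : Fin (m + 1) → ℕ :=
  Fin.cons (α (Fin.last m) + 1) fun j => α j.castSucc

theorem raise_zero {m : ℕ} (α : Fin (m + 1) → ℕ) : raise α 0 = α (Fin.last m) + 1 := rfl

theorem raise_succ {m : ℕ} (α : Fin (m + 1) → ℕ) (j : Fin m) : raise α j.succ = α j.castSucc :=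
  rfl

theorem raise_injective {m : ℕ} : Function.Injective (raise (m := m)) := by
  intro α β h
  funext j
  refine Fin.lastCases ?_ (fun j => ?_) j
  · have := congrFun h 0
    simpa [raise_zero] using this
  · exact congrFun h j.succ

/-- The lifts in `levelSum` are built for this: raising shifts the parameter `r` cyclically, and
passing from `r = n - 1` back to `r = 0` raises the level `l` by one. -/
theorem BelowEq.raise {m : ℕ} {α β : Fin (m + 1) → ℕ} (h : BelowEq β α) :
    BelowEq (raise β) (raise α) := by
  have e1 : ∀ (α : Fin (m + 1) → ℕ) l r, r ≤ m →
      levelSum (PermutedBasement.raise α) l (r + 1) = levelSum α l r := by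
    intro α l r hr
    rw [levelSum, levelSum, Fin.sum_univ_succ, Fin.sum_univ_castSucc]
    simp only [raise_zero, raise_succ]
    simp [hr, add_comm]
  have e2 : ∀ (α : Fin (m + 1) → ℕ) l,
      levelSum (PermutedBasement.raise α) (l + 1) 0 = levelSum α l m := by
    intro α l
    rw [levelSum, levelSum, Fin.sum_univ_succ, Fin.sum_univ_castSucc]
    simp only [raise_zero, raise_succ]
    have : ∀ x : Fin m, ¬ m ≤ x.1 := fun x => by omega
    simp [add_comm, this]
    omega
  have e3 : ∀ (α : Fin (m + 1) → ℕ),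
      levelSum (PermutedBasement.raise α) 0 0 = levelSum α 0 0 + 1 := by
    intro α
    rw [levelSum, levelSum, Fin.sum_univ_succ, Fin.sum_univ_castSucc]
    simp only [raise_zero, raise_succ]
    simp
    omega
  intro l r hr
  rcases r with _ | r
  · rcases l with _ | l
    · rw [e3, e3]
      exact Nat.add_le_add_right (h 0 0 (Nat.zero_le _)) 1
    · rw [e2, e2]
      exact h l m (by omega)
  · rw [e1 _ _ _ (by omega), e1 _ _ _ (by omega)]
    exact h l r (by omega)

/-- Every composition is obtained from `0` by raising and by exchanging adjacent entries
`β_i > β_{i+1}`. -/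
theorem composition_induction {m : ℕ} {P : (Fin (m + 1) → ℕ) → Prop} (zero : P 0)
    (swap : ∀ β i, β (hi i) < β (lo i) → P β → P (β ∘ simple i))
    (raise : ∀ β, P β → P (raise β)) (α : Fin (m + 1) → ℕ) : P α := by
  -- The outer induction is on the size, which undoing a raise lowers. The inner one is on `∑ j
  -- α_j`, which sorting an adjacent ascent lowers.
  induction hd : ∑ j, α j using Nat.strong_induction_on generalizing α with
  | _ d ihd =>
  induction hk : ∑ j, j.1 * α j using Nat.strong_induction_on generalizing α with
  | _ k ihk =>
  by_cases hs : ∃ i : Fin (m + 1 - 1), α (lo i) < α (hi i)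
  · obtain ⟨i, hi'⟩ := hs
    have e : (α ∘ simple i) ∘ simple i = α := by
      funext j
      simp only [Function.comp_apply, simple_simple]
    rw [← e]
    refine swap _ i (by rwa [act_simple_lo, act_simple_hi]) (ihk _ ?_ _ ?_ rfl)
    · rw [← hk, sum_split i, sum_split i, act_simple_lo, act_simple_hi,
        Finset.sum_congr rfl (g := fun j : Fin (m + 1) => j.1 * α j)]
      · simp only [lo, hi] at hi' ⊢
        nlinarith
      · intro j hj
        rw [Finset.mem_erase, Finset.mem_erase] at hj
        rw [act_simple_of_ne i α j hj.2.1 hj.1]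
    · rw [← hd]
      exact Equiv.sum_comp (simple i) α
  · push Not at hs
    have hanti : Antitone α := Fin.antitone_iff_succ_le.mpr hs
    rcases Nat.eq_zero_or_pos (α 0) with h0 | h0
    · have : α = 0 := funext fun j => Nat.le_zero.mp (h0 ▸ hanti (Fin.zero_le j))
      rwa [this]
    · have e : PermutedBasement.raise
          (Fin.snoc (fun j : Fin m => α j.succ) (α 0 - 1) : Fin (m + 1) → ℕ) = α := by
        funext j
        refine Fin.cases ?_ (fun j => ?_) j
        · rw [raise_zero, Fin.snoc_last]; omega
        · rw [raise_succ, Fin.snoc_castSucc]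
      rw [← e]
      refine raise _ (ihd _ ?_ _ rfl)
      rw [← hd, Fin.sum_univ_castSucc, Fin.sum_univ_succ]
      simp only [Fin.snoc_last, Fin.snoc_castSucc]
      omega

/-! ### Existence of the nonsymmetric Macdonald polynomials -/

/-- `k_i` counts the positions that exceed `i` when the pairs `(α_j, j)` are ordered
lexicographically. Exchanging unequal neighbours and raising both transport this order, so they
merely permute the `k_i`. -/
theorem kExp_eq_sum {n : ℕ} (α : Fin n → ℕ) (i : Fin n) :
    kExp α i = ∑ j, if α i < α j ∨ (α i = α j ∧ i < j) then 1 else 0 := by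
  rw [kExp, Finset.card_filter, Finset.card_filter, ← Finset.sum_add_distrib]
  refine Finset.sum_congr rfl fun j _ => ?_
  rcases lt_trichotomy i j with h | rfl | h
  · simp only [h, h.not_gt, false_and, true_and, and_true, if_false, zero_add, le_iff_lt_or_eq]
  · simp
  · simp [h, h.not_gt]

theorem simple_lt {n : ℕ} (i : Fin (n - 1)) {x y : Fin n} (hxy : x < y)
    (h : ¬ (x = lo i ∧ y = hi i)) : simple i x < simple i y := by
  have hlo : (lo i).1 = i.1 := rfl
  have hhi : (hi i).1 = i.1 + 1 := rfl
  simp only [simple, Equiv.swap_apply_def]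
  simp only [Fin.ext_iff] at h ⊢
  rw [Fin.lt_def] at hxy ⊢
  split_ifs <;> omega

theorem kExp_swap {n : ℕ} (i : Fin (n - 1)) {α : Fin n → ℕ} (h : α (lo i) ≠ α (hi i))
    (j : Fin n) : kExp (α ∘ simple i) j = kExp α (simple i j) := by
  rw [kExp_eq_sum, kExp_eq_sum]
  conv_rhs => rw [← Equiv.sum_comp (simple i)]
  refine Finset.sum_congr rfl fun k _ => ?_
  simp only [Function.comp_apply]
  have key : α (simple i j) = α (simple i k) → (j < k ↔ simple i j < simple i k) := by
    intro he
    constructor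
    · intro hjk
      refine simple_lt i hjk ?_
      rintro ⟨rfl, rfl⟩
      rw [simple_lo, simple_hi] at he
      exact h he.symm
    · intro hjk
      have := simple_lt i hjk ?_
      · rwa [simple_simple, simple_simple] at this
      · rintro ⟨h1, h2⟩
        rw [h1, h2] at he
        exact h he
  by_cases he : α (simple i j) = α (simple i k)
  · simp [he, key he]
  · simp [he]

theorem kExp_lo_of_eq {n : ℕ} (i : Fin (n - 1)) {α : Fin n → ℕ} (h : α (lo i) = α (hi i)) :
    kExp α (lo i) = kExp α (hi i) + 1 := by
  have hlo : (lo i).1 = i.1 := rfl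
  have hhi : (hi i).1 = i.1 + 1 := rfl
  rw [kExp_eq_sum, kExp_eq_sum, sum_split i, sum_split i, h]
  have : ∀ j ∈ (Finset.univ.erase (lo i)).erase (hi i), (lo i < j ↔ hi i < j) := by
    intro j hj
    rw [Finset.mem_erase, Finset.mem_erase] at hj
    simp only [ne_eq, Fin.ext_iff] at hj
    rw [Fin.lt_def, Fin.lt_def]
    omega
  rw [Finset.sum_congr rfl (g := fun j => if α (hi i) < α j ∨ α (hi i) = α j ∧ hi i < j then 1
    else 0) fun j hj => by simp only [this j hj]]
  have e1 : lo i < hi i := by rw [Fin.lt_def]; omega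
  simp [e1, e1.not_gt]
  omega

theorem kExp_raise_zero {m : ℕ} (α : Fin (m + 1) → ℕ) :
    kExp (raise α) 0 = kExp α (Fin.last m) := by
  rw [kExp_eq_sum, kExp_eq_sum, Fin.sum_univ_succ, Fin.sum_univ_castSucc]
  simp only [raise_zero, raise_succ, lt_irrefl, and_false, or_false, if_false, zero_add, add_zero]
  refine Finset.sum_congr rfl fun j _ => ?_
  have h1 : (0 : Fin (m + 1)) < j.succ := Fin.succ_pos j
  have h2 : ¬ Fin.last m < j.castSucc := (Fin.castSucc_lt_last j).not_gt
  simp only [h1, h2, and_true, and_false, or_false]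
  split_ifs <;> omega

theorem kExp_raise_succ {m : ℕ} (α : Fin (m + 1) → ℕ) (i : Fin m) :
    kExp (raise α) i.succ = kExp α i.castSucc := by
  rw [kExp_eq_sum, kExp_eq_sum, Fin.sum_univ_succ, Fin.sum_univ_castSucc]
  simp only [raise_zero, raise_succ, Fin.succ_lt_succ_iff, Fin.castSucc_lt_castSucc_iff,
    Fin.castSucc_lt_last, and_true]
  rw [add_comm]
  congr 1
  have : ¬ i.succ < 0 := Fin.not_lt_zero _
  simp only [this, and_false, or_false]
  split_ifs <;> omega

theorem kExp_const_zero {n : ℕ} (i : Fin n) : kExp (0 : Fin n → ℕ) i = n - 1 - i.1 := by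
  rw [kExp_eq_sum]
  simp only [Pi.zero_apply, lt_irrefl, false_or, true_and, ← Finset.card_filter]
  rw [Finset.filter_lt_eq_Ioi, Fin.card_Ioi]

/-- The eigenvalue of `Y_i` on `E_α`. -/
def spectrumAt {n : ℕ} (α : Fin n → ℕ) (i : Fin n) : Qqt := q⁻¹ ^ α i * t ^ kExp α i

theorem q_ne_zero : q ≠ 0 := RatFunc.X_ne_zero

/-- The condition on `c` is exactly the cancellation of the `f` terms that the cross relations
between `T_i` and `Y_i`, `Y_{i+1}` produce. -/
theorem Y_intertwine {n : ℕ} {i : Fin (n - 1)} {f : Poly n} {y : Fin n → Qqt} {c : Qqt}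
    (hf : ∀ j, Y j f = y j • f) (hc : c * (y (lo i) - y (hi i)) = (1 - t) * y (lo i))
    (j : Fin n) : Y j (T i f + c • f) = y (simple i j) • (T i f + c • f) := by
  rcases eq_or_ne j (lo i) with rfl | h1
  · have h := LinearMap.congr_fun (T_mul_Y_hi i) f
    simp only [Module.End.mul_apply, LinearMap.add_apply, LinearMap.smul_apply,
      Module.End.one_apply, map_add, map_smul, hf] at h
    rw [map_add, map_smul, hf, simple_lo, smul_add, h]
    have : (c * y (lo i)) • f = ((1 - t) * y (lo i) + c * y (hi i)) • f := by
      congr 1; linear_combination hc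
    rw [smul_smul, this, add_smul, smul_smul, smul_smul, mul_comm c (y (hi i))]
    abel
  rcases eq_or_ne j (hi i) with rfl | h2
  · have h := LinearMap.congr_fun (Y_hi_mul_T i) f
    simp only [Module.End.mul_apply, LinearMap.add_apply, LinearMap.smul_apply,
      Module.End.one_apply, map_smul, hf] at h
    rw [map_add, map_smul, hf, simple_hi, h, smul_add, smul_add, add_assoc, smul_smul, smul_smul,
      smul_smul, ← add_smul]
    congr 2
    linear_combination -hc
  · have h := LinearMap.congr_fun (commute_Y i j h1 h2).eq f
    simp only [Module.End.mul_apply] at h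
    rw [map_add, map_smul, ← h, hf, map_smul, simple_of_ne i h1 h2, smul_add, smul_comm c]

/-- The scalar is `(1 - t) t^k / (t^k - q^{a-b} t^l)`. It differs from `1 - t` by `q` times a
fraction whose denominator takes the nonzero value `t^k` at `q = 0`; this is where `b < a` is
needed. -/
theorem exists_intertwine_coeff {a b : ℕ} (h : b < a) (k l : ℕ) :
    ∃ e ∈ regularSubring,
      ((1 - t) + q * e) * (q⁻¹ ^ a * t ^ k - q⁻¹ ^ b * t ^ l) = (1 - t) * (q⁻¹ ^ a * t ^ k) := by
  obtain ⟨d, rfl⟩ := Nat.exists_eq_add_of_lt h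
  set p : Polynomial Qt := Polynomial.C (RatFunc.X ^ k) -
    Polynomial.C (RatFunc.X ^ l) * Polynomial.X ^ (d + 1) with hp
  have hp0 : p.eval 0 ≠ 0 := by
    simp [hp, RatFunc.X_ne_zero]
  have hD : algebraMap (Polynomial Qt) Qqt p = t ^ k - q ^ (d + 1) * t ^ l := by
    simp only [hp, map_sub, map_mul, map_pow, RatFunc.algebraMap_C, RatFunc.algebraMap_X, t, q]
    ring
  have hD0 : t ^ k - q ^ (d + 1) * t ^ l ≠ 0 := by
    rw [← hD]
    intro h0
    rw [map_eq_zero_iff _ (RatFunc.algebraMap_injective Qt)] at h0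
    rw [h0] at hp0
    simp at hp0
  have hi' := inv_algebraMap_mem hp0
  rw [hD] at hi'
  refine ⟨(1 - t) * q ^ d * t ^ l * (t ^ k - q ^ (d + 1) * t ^ l)⁻¹,
    mul_mem (mul_mem (mul_mem (sub_mem (one_mem _) t_mem) (pow_mem q_mem _)) (pow_mem t_mem _)) hi',
    ?_⟩
  have hq := q_ne_zero
  have e1 : q⁻¹ ^ (b + d + 1) * t ^ k - q⁻¹ ^ b * t ^ l =
      q⁻¹ ^ (b + d + 1) * (t ^ k - q ^ (d + 1) * t ^ l) := by
    rw [inv_pow, inv_pow]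
    field_simp
    ring
  rw [e1]
  generalize hD' : t ^ k - q ^ (d + 1) * t ^ l = D at hD0
  have e2 : (1 - t) + q * ((1 - t) * q ^ d * t ^ l * D⁻¹) = (1 - t) * t ^ k * D⁻¹ := by
    rw [eq_mul_inv_iff_mul_eq₀ hD0, add_mul, mul_assoc, mul_assoc _ D⁻¹, inv_mul_cancel₀ hD0,
      ← hD']
    ring
  rw [e2]
  field_simp

/-- The exponent vector of a composition. -/
abbrev expo {n : ℕ} (α : Fin n → ℕ) : Fin n →₀ ℕ := Finsupp.equivFunOnFinite.symm α

theorem expo_apply {n : ℕ} (α : Fin n → ℕ) (j : Fin n) : expo α j = α j := rfl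

theorem expo_coe {n : ℕ} (m : Fin n →₀ ℕ) : expo (m : Fin n → ℕ) = m :=
  Finsupp.equivFunOnFinite.symm_apply_apply m

theorem tailT_one {n k : ℕ} (hk : k ≤ n - 1) :
    tailT n k (1 : Poly n) = t ^ (n - 1 - k) • 1 := by
  induction hk using Nat.decreasingInduction with
  | self => simp [tailT_of_le]
  | of_succ k hk ih =>
    have s := tailT_step (⟨k, hk⟩ : Fin (n - 1))
    simp only [] at s
    rw [s, Module.End.mul_apply, T_one, map_smul, ih, smul_smul, ← pow_succ']
    congr 2
    omega

theorem headInv_one {n k : ℕ} (hk : k ≤ n - 1) :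
    headInv n k (1 : Poly n) = t⁻¹ ^ k • 1 := by
  induction k with
  | zero => simp [headInv_zero]
  | succ k ih =>
    have s := headInv_step (⟨k, hk⟩ : Fin (n - 1))
    have hT := LinearMap.congr_fun (inv_mul_T (⟨k, hk⟩ : Fin (n - 1))) 1
    rw [Module.End.mul_apply, T_one, map_smul, Module.End.one_apply] at hT
    simp only [] at s
    rw [s, Module.End.mul_apply, ih (by omega), map_smul, pow_succ, mul_smul,
      ← inv_smul_smul₀ t_ne_zero ((_ : Module.End Qqt (Poly n)) (1 : Poly n)), hT]

theorem Y_one {n : ℕ} (i : Fin n) : Y i (1 : Poly n) = spectrumAt (0 : Fin n → ℕ) i • 1 := by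
  have := i.2
  rw [Y_eq, LinearMap.smul_apply, Module.End.mul_apply, Module.End.mul_apply,
    tailT_one (by omega), map_smul, map_smul, AlgHom.toLinearMap_apply, map_one,
    headInv_one (by omega), spectrumAt, kExp_const_zero, smul_smul, smul_smul, Pi.zero_apply,
    pow_zero, one_mul, inv_pow]
  congr 1
  have := pow_ne_zero i.1 t_ne_zero
  field_simp

theorem raiseOp_monomial {m : ℕ} (μ : Fin (m + 1) →₀ ℕ) (c : Qqt) :
    raiseOp m (monomial μ c) = monomial (expo (raise μ)) (q⁻¹ ^ μ (Fin.last m) * c) := by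
  have h1 : ∀ j : Fin m, g (m + 1) (X j.castSucc) = X j.succ := fun j =>
    g_X_of_lt _ (by simp)
  have h2 : g (m + 1) (X (Fin.last m)) = C q⁻¹ * X 0 := g_X_last _ rfl
  rw [raiseOp, Module.End.mul_apply, mulX_apply, AlgHom.toLinearMap_apply, monomial_eq,
    monomial_eq, Finsupp.prod_fintype _ _ (by simp), Finsupp.prod_fintype _ _ (by simp),
    Fin.prod_univ_castSucc, Fin.prod_univ_succ, map_mul, map_mul, map_prod, map_pow, g_C, h2]
  simp only [map_pow, h1, expo_apply, raise_zero, raise_succ, map_mul]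
  ring

theorem raiseOp_eq_sum {m : ℕ} (f : Poly (m + 1)) :
    raiseOp m f = ∑ μ ∈ f.support,
      monomial (expo (raise μ)) (q⁻¹ ^ μ (Fin.last m) * coeff μ f) := by
  conv_lhs => rw [f.as_sum, map_sum]
  simp only [raiseOp_monomial]

theorem coeff_raiseOp {m : ℕ} (f : Poly (m + 1)) (α : Fin (m + 1) → ℕ) :
    coeff (expo (raise α)) (raiseOp m f) = q⁻¹ ^ α (Fin.last m) * coeff (expo α) f := by
  rw [raiseOp_eq_sum, coeff_sum, Finset.sum_eq_single (expo α)]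
  · exact coeff_monomial _ _ _ |>.trans (if_pos rfl)
  · intro μ _ hne
    rw [coeff_monomial, if_neg]
    intro h
    have h' := raise_injective (Finsupp.equivFunOnFinite.symm.injective h)
    exact hne (by rw [← h', expo_coe])
  · intro h
    rw [notMem_support_iff.mp h]
    simp

theorem mem_support_raiseOp {m : ℕ} {f : Poly (m + 1)} {μ : Fin (m + 1) →₀ ℕ}
    (h : μ ∈ (raiseOp m f).support) : ∃ ν ∈ f.support, μ = expo (raise ν) := by
  rw [mem_support_iff, raiseOp_eq_sum, coeff_sum] at h
  obtain ⟨ν, hν, hne⟩ := Finset.exists_ne_zero_of_sum_ne_zero h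
  rw [coeff_monomial] at hne
  exact ⟨ν, hν, (ite_ne_right_iff.mp hne).1.symm⟩

theorem mem_regularPoly_of_headInv {n k : ℕ} (hk : k ≤ n - 1) {f : Poly n}
    (h : headInv n k f ∈ regularPoly n) : f ∈ regularPoly n := by
  induction k with
  | zero => rwa [headInv_zero] at h
  | succ k ih =>
    have s := headInv_step (⟨k, hk⟩ : Fin (n - 1))
    simp only [] at s
    refine ih (by omega) ?_
    have := T_mem_regularPoly ⟨k, hk⟩ h
    rwa [s, Module.End.mul_apply, ← Module.End.mul_apply (T _), T_mul_inv] at this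

/-- Taken alone, `g` introduces poles. But `Y_n` is `g` followed by invertible operators whose
inverses preserve regularity, so the eigenvalue equation bounds the pole of `g E` by `q^{-a}`. -/
theorem smul_g_mem_regularPoly {m : ℕ} {E : Poly (m + 1)} (hE : E ∈ regularPoly (m + 1))
    {a k : ℕ} (h : Y (Fin.last m) E = (q⁻¹ ^ a * t ^ k) • E) :
    q ^ a • g (m + 1) E ∈ regularPoly (m + 1) := by
  refine mem_regularPoly_of_headInv (k := m) (by omega) ?_
  rw [Y_eq, tailT_of_le (by simp), mul_one, LinearMap.smul_apply, Module.End.mul_apply,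
    AlgHom.toLinearMap_apply, Fin.val_last] at h
  have h' : headInv (m + 1) m (q ^ a • g (m + 1) E) = (t⁻¹ ^ m * t ^ k) • E := by
    rw [map_smul, ← inv_smul_smul₀ (pow_ne_zero m t_ne_zero) (headInv (m + 1) m _), h, smul_smul,
      smul_smul]
    congr 1
    have := q_ne_zero
    rw [inv_pow, inv_pow]
    field_simp
  rw [h']
  exact smul_mem_regularPoly (mul_mem (pow_mem t_inv_mem _) (pow_mem t_mem _)) hE

/-- A nonsymmetric Macdonald polynomial that is triangular and has no pole at `q = 0`. -/
def IsTriangularMacdonald {n : ℕ} (α : Fin n → ℕ) (E : Poly n) : Prop :=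
  IsNonsymmetricMacdonald α E ∧ (∀ m ∈ E.support, BelowEq m α) ∧ E ∈ regularPoly n

theorem isTriangularMacdonald_zero (n : ℕ) : IsTriangularMacdonald (0 : Fin n → ℕ) 1 := by
  refine ⟨⟨?_, Y_one⟩, fun m hm => ?_, one_mem _⟩
  · have : expo (0 : Fin n → ℕ) = 0 := Finsupp.ext fun _ => rfl
    exact (congrArg (fun m => coeff m (1 : Poly n)) this).trans coeff_zero_one
  · have : m = 0 := by
      rw [mem_support_iff, coeff_one] at hm
      exact (ite_ne_right_iff.mp hm).1.symm
    rw [this]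
    exact BelowEq.refl _

theorem IsTriangularMacdonald.raise {m : ℕ} {α : Fin (m + 1) → ℕ} {E : Poly (m + 1)}
    (h : IsTriangularMacdonald α E) :
    IsTriangularMacdonald (raise α) (q ^ α (Fin.last m) • raiseOp m E) := by
  obtain ⟨⟨h1, hY⟩, h2, h3⟩ := h
  have hq := q_ne_zero
  refine ⟨⟨?_, fun i => ?_⟩, fun μ hμ => ?_, ?_⟩
  · rw [coeff_smul]
    erw [coeff_raiseOp, h1]
    rw [mul_one, inv_pow, smul_eq_mul, mul_inv_cancel₀ (pow_ne_zero _ hq)]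
  · rw [map_smul, smul_comm]
    congr 1
    refine Fin.cases ?_ (fun j => ?_) i
    · have := LinearMap.congr_fun (Y_zero_mul_raiseOp m) E
      rw [Module.End.mul_apply, LinearMap.smul_apply, Module.End.mul_apply, hY, map_smul] at this
      rw [this, raise_zero, kExp_raise_zero, smul_smul, pow_succ']
      congr 1
      ring
    · have := LinearMap.congr_fun (Y_hi_mul_raiseOp (m := m) j) E
      rw [Module.End.mul_apply, Module.End.mul_apply, hY, map_smul] at this
      rw [raise_succ, kExp_raise_succ]
      exact this
  · obtain ⟨ν, hν, rfl⟩ := mem_support_raiseOp (support_smul hμ)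
    exact (h2 ν hν).raise
  · have := smul_g_mem_regularPoly h3 (hY (Fin.last m))
    rw [raiseOp, Module.End.mul_apply, mulX_apply, AlgHom.toLinearMap_apply, ← mul_smul_comm]
    exact mul_mem (monomial_mem_regularPoly _ (one_mem _)) this

theorem IsTriangularMacdonald.swap {n : ℕ} {α : Fin n → ℕ} {E : Poly n} {i : Fin (n - 1)}
    (h : IsTriangularMacdonald α E) (hα : α (hi i) < α (lo i)) :
    ∃ e ∈ regularSubring, IsTriangularMacdonald (α ∘ simple i) (T i E + ((1 - t) + q * e) • E) := by
  obtain ⟨⟨h1, hY⟩, h2, h3⟩ := h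
  obtain ⟨e, he, hc⟩ := exists_intertwine_coeff hα (kExp α (lo i)) (kExp α (hi i))
  refine ⟨e, he, ⟨?_, fun j => ?_⟩, fun μ hμ => ?_, ?_⟩
  · have hne : ∀ m ∈ E.support, m ≠ expo α → ¬ Hull i m (expo (α ∘ simple i)) := by
      intro m hm hne hH
      apply hne
      rw [← expo_coe m, (h2 m hm).eq_of_hull hα hH]
    have hE : coeff (expo (α ∘ simple i)) E = 0 := by
      by_contra hne'
      refine hne _ (mem_support_iff.mpr hne') ?_ ⟨fun _ _ _ => rfl, rfl, le_max_left _ _,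
        le_max_right _ _⟩
      intro heq
      have := DFunLike.congr_fun heq (lo i)
      rw [expo_apply, expo_apply, act_simple_lo] at this
      omega
    rw [coeff_add, coeff_smul]
    erw [hE]
    rw [smul_zero, add_zero, T_monomial_smul, coeff_sum, Finset.sum_eq_single (expo α)]
    · rw [coeff_smul]
      erw [h1, coeff_T_monomial (by simpa using hα) fun _ => rfl]
      simp
    · intro m hm hm'
      rw [coeff_smul]
      by_contra hcon
      exact hne m hm hm' ((T_monomial_regular_hull i m).2 _ (right_ne_zero_of_mul hcon))
    · intro hns
      rw [notMem_support_iff.mp hns, zero_smul, coeff_zero]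
  · rw [kExp_swap i hα.ne']
    exact Y_intertwine hY hc j
  · rcases Finset.mem_union.mp (support_add hμ) with hμ | hμ
    · obtain ⟨m, hm, hH⟩ := exists_hull_of_mem_support_T hμ
      exact (h2 m hm).hull hα hH
    · exact (h2 μ (support_smul hμ)).hull hα
        ⟨fun _ _ _ => rfl, rfl, le_max_left _ _, le_max_right _ _⟩
  · exact add_mem (T_mem_regularPoly i h3) (smul_mem_regularPoly
      (add_mem (sub_mem (one_mem _) t_mem) (mul_mem q_mem he)) h3)

theorem exists_isTriangularMacdonald {n : ℕ} (α : Fin n → ℕ) :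
    ∃ E, IsTriangularMacdonald α E := by
  rcases n with _ | m
  · rw [Subsingleton.elim α 0]
    exact ⟨1, isTriangularMacdonald_zero 0⟩
  · induction α using composition_induction with
    | zero => exact ⟨1, isTriangularMacdonald_zero _⟩
    | swap β i hβ ih =>
      obtain ⟨E, hE⟩ := ih
      obtain ⟨e, -, h⟩ := hE.swap hβ
      exact ⟨_, h⟩
    | raise β ih =>
      obtain ⟨E, hE⟩ := ih
      exact ⟨_, hE.raise⟩

/-! ### Uniqueness of the nonsymmetric Macdonald polynomials -/

theorem q_pow_mul_t_pow_injective {a b k l : ℕ} (h : q⁻¹ ^ a * t ^ k = q⁻¹ ^ b * t ^ l) :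
    a = b ∧ k = l := by
  have hq := q_ne_zero
  have h1 : q ^ b * t ^ k = q ^ a * t ^ l := by
    rw [inv_pow, inv_pow] at h
    field_simp at h
    linear_combination h
  have h2 : algebraMap (Polynomial Qt) Qqt (Polynomial.monomial b (RatFunc.X ^ k)) =
      algebraMap (Polynomial Qt) Qqt (Polynomial.monomial a (RatFunc.X ^ l)) := by
    simp only [← Polynomial.C_mul_X_pow_eq_monomial, map_mul, map_pow, RatFunc.algebraMap_C,
      RatFunc.algebraMap_X]
    unfold q t at h1
    linear_combination h1
  have hX : ∀ k : ℕ, (RatFunc.X ^ k : Qt) ≠ 0 := fun k => pow_ne_zero k RatFunc.X_ne_zero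
  rcases (Polynomial.monomial_eq_monomial_iff).mp (RatFunc.algebraMap_injective Qt h2) with
    ⟨h3, h4⟩ | ⟨h3, -⟩
  · refine ⟨h3.symm, ?_⟩
    have h5 : algebraMap (Polynomial ℚ) Qt (Polynomial.X ^ k) =
        algebraMap (Polynomial ℚ) Qt (Polynomial.X ^ l) := by
      simpa only [map_pow, RatFunc.algebraMap_X] using h4
    have := congrArg Polynomial.natDegree (RatFunc.algebraMap_injective ℚ h5)
    simpa using this
  · exact absurd h3 (hX k)

theorem spectrumAt_injective {n : ℕ} {α β : Fin n → ℕ}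
    (h : ∀ i, spectrumAt α i = spectrumAt β i) : α = β :=
  funext fun i => (q_pow_mul_t_pow_injective (h i)).1

theorem coeff_eq_zero_of_not_belowEq {n : ℕ} {E : (Fin n → ℕ) → Poly n}
    (hE : ∀ α, IsTriangularMacdonald α (E α)) {α β : Fin n → ℕ} (h : ¬ BelowEq β α) :
    coeff (expo β) (E α) = 0 := by
  by_contra hne
  exact h ((hE α).2.1 _ (mem_support_iff.mpr hne))

theorem linearIndependent_of_isTriangular {n : ℕ} {E : (Fin n → ℕ) → Poly n}
    (hE : ∀ α, IsTriangularMacdonald α (E α)) : LinearIndependent Qqt E := by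
  classical
  rw [linearIndependent_iff']
  intro s c hc
  by_contra! hcon
  obtain ⟨α₀, hα₀, hne⟩ := hcon
  -- For an index that is maximal in the order, triangularity leaves only `E α` to contribute to the
  -- coefficient of `x^α`.
  obtain ⟨α, hα, hmax⟩ := Finset.exists_max_image (s.filter fun α => c α ≠ 0) belowCard
    ⟨α₀, Finset.mem_filter.mpr ⟨hα₀, hne⟩⟩
  rw [Finset.mem_filter] at hα
  have h := congrArg (coeff (expo α)) hc
  rw [coeff_sum, coeff_zero, Finset.sum_eq_single α] at h
  · rw [coeff_smul] at h
    erw [(hE α).1.1] at h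
    exact hα.2 (by simpa using h)
  · intro β hβ hβα
    rw [coeff_smul, smul_eq_mul, mul_eq_zero, or_iff_not_imp_left]
    intro hcβ
    refine coeff_eq_zero_of_not_belowEq hE fun hle => ?_
    exact absurd (hmax β (Finset.mem_filter.mpr ⟨hβ, hcβ⟩)) (belowCard_lt hle hβα.symm).not_ge
  · exact fun h => absurd hα.1 h

theorem mem_span_of_isTriangular {n : ℕ} {E : (Fin n → ℕ) → Poly n}
    (hE : ∀ α, IsTriangularMacdonald α (E α)) (f : Poly n) :
    f ∈ Submodule.span Qqt (Set.range E) := by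
  have hmono : ∀ α : Fin n → ℕ, (monomial (expo α) 1 : Poly n) ∈
      Submodule.span Qqt (Set.range E) := by
    intro α
    -- Unitriangular inversion: `x^α` is `E α` minus monomials strictly below it, and `belowCard`
    -- makes the order well-founded.
    induction hk : belowCard α using Nat.strong_induction_on generalizing α with
    | _ k ih =>
    subst hk
    have hα : expo α ∈ (E α).support := by
      rw [mem_support_iff]
      erw [(hE α).1.1]
      exact one_ne_zero
    have h1 : coeff (expo α) (E α) = 1 := (hE α).1.1
    have h2 := (E α).as_sum
    rw [← Finset.add_sum_erase _ _ hα, h1] at h2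
    rw [eq_comm, ← eq_sub_iff_add_eq] at h2
    rw [h2]
    refine sub_mem (Submodule.subset_span ⟨α, rfl⟩) (sum_mem fun m hm => ?_)
    rw [Finset.mem_erase] at hm
    have hne : (m : Fin n → ℕ) ≠ α := fun h => hm.1 (by rw [← h, expo_coe])
    have h3 := ih _ (belowCard_lt ((hE α).2.1 m hm.2) hne) m rfl
    rw [expo_coe] at h3
    have h4 := Submodule.smul_mem _ (coeff m (E α)) h3
    rwa [smul_monomial, smul_eq_mul, mul_one] at h4
  rw [f.as_sum]
  refine sum_mem fun m _ => ?_
  have h := Submodule.smul_mem _ (coeff m f) (hmono m)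
  rwa [smul_monomial, smul_eq_mul, mul_one, expo_coe] at h

/-- Expanding in the eigenbasis, every index that occurs has spectrum `y`. Distinct compositions
have distinct spectra, so only one index occurs. -/
theorem exists_of_eigenvector {n : ℕ} {E : (Fin n → ℕ) → Poly n}
    (hE : ∀ α, IsTriangularMacdonald α (E α)) {f : Poly n} (hf : f ≠ 0) {y : Fin n → Qqt}
    (hy : ∀ i, Y i f = y i • f) : ∃ α, (∀ i, y i = spectrumAt α i) ∧ ∃ c : Qqt, f = c • E α := by
  obtain ⟨c, rfl⟩ := Finsupp.mem_span_range_iff_exists_finsupp.mp (mem_span_of_isTriangular hE f)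
  have key : ∀ i, ∀ α ∈ c.support, y i = spectrumAt α i := by
    intro i α hα
    have h := hy i
    rw [Finsupp.sum, map_sum, Finset.smul_sum, ← sub_eq_zero, ← Finset.sum_sub_distrib] at h
    have h' : ∑ α ∈ c.support, (c α * (spectrumAt α i - y i)) • E α = 0 := by
      rw [← h]
      refine Finset.sum_congr rfl fun β _ => ?_
      rw [map_smul, (hE β).1.2 i, mul_sub, sub_smul, smul_smul, smul_smul, mul_comm (y i)]
      rfl
    have h0 := linearIndependent_iff'.mp (linearIndependent_of_isTriangular hE) _ _ h' α hα
    rcases mul_eq_zero.mp h0 with h0 | h0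
    · exact absurd h0 (Finsupp.mem_support_iff.mp hα)
    · exact (sub_eq_zero.mp h0).symm
  have hne : c.support.Nonempty := by
    rw [Finset.nonempty_iff_ne_empty]
    intro h
    exact hf (by rw [Finsupp.sum, h, Finset.sum_empty])
  obtain ⟨α, hα⟩ := hne
  refine ⟨α, fun i => key i α hα, c α, ?_⟩
  have hs : c.support = {α} := by
    refine Finset.eq_singleton_iff_unique_mem.mpr ⟨hα, fun β hβ => ?_⟩
    exact spectrumAt_injective fun i => by rw [← key i β hβ, ← key i α hα]
  rw [Finsupp.sum, hs, Finset.sum_singleton]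

theorem existsUnique_isNonsymmetricMacdonald {n : ℕ} (α : Fin n → ℕ) :
    ∃! E : Poly n, IsNonsymmetricMacdonald α E := by
  choose E hE using exists_isTriangularMacdonald (n := n)
  refine ⟨E α, (hE α).1, fun f hf => ?_⟩
  have hf0 : f ≠ 0 := by
    rintro rfl
    exact zero_ne_one ((coeff_zero _).symm.trans hf.1)
  obtain ⟨β, hβ, c, rfl⟩ := exists_of_eigenvector hE hf0 hf.2
  obtain rfl := spectrumAt_injective hβ
  have h := hf.1
  rw [coeff_smul, (hE α).1.1, smul_eq_mul, mul_one] at h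
  rw [h, one_smul]

theorem isTriangularMacdonald_nonsymmetricMacdonald {n : ℕ} (α : Fin n → ℕ) :
    IsTriangularMacdonald α (nonsymmetricMacdonald α) := by
  obtain ⟨E, hE⟩ := exists_isTriangularMacdonald α
  have h : ∃ E : Poly n, IsNonsymmetricMacdonald α E := ⟨E, hE.1⟩
  have h' : nonsymmetricMacdonald α = E := by
    rw [nonsymmetricMacdonald, dif_pos h]
    exact (existsUnique_isNonsymmetricMacdonald α).unique h.choose_spec hE.1
  rwa [h']

theorem nonsymmetricMacdonald_mem_regularPoly {n : ℕ} (α : Fin n → ℕ) :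
    nonsymmetricMacdonald α ∈ regularPoly n :=
  (isTriangularMacdonald_nonsymmetricMacdonald α).2.2

/-- For equal entries `c = -t` solves the intertwining condition. If `(T_i - t) E_α` were nonzero,
it would have the spectrum of `α` with positions `i` and `i + 1` exchanged. Its powers of `q` force
the index `α`, but its powers of `t` are then in the wrong order. -/
theorem T_nonsymmetricMacdonald_of_eq {n : ℕ} {i : Fin (n - 1)} {α : Fin n → ℕ}
    (h : α (lo i) = α (hi i)) :
    T i (nonsymmetricMacdonald α) = t • nonsymmetricMacdonald α := by
  have hE := isTriangularMacdonald_nonsymmetricMacdonald (n := n)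
  set E := nonsymmetricMacdonald α
  have hlo : spectrumAt α (lo i) = t * spectrumAt α (hi i) := by
    rw [spectrumAt, spectrumAt, kExp_lo_of_eq i h, h, pow_succ]
    ring
  have hY : ∀ j, Y j (T i E + (-t) • E) =
      spectrumAt α (simple i j) • (T i E + (-t) • E) :=
    Y_intertwine (y := spectrumAt α) (hE α).1.2 (by rw [hlo]; ring)
  by_contra hne
  have hne' : T i E + (-t) • E ≠ 0 := by
    rwa [neg_smul, ← sub_eq_add_neg, sub_ne_zero]
  obtain ⟨β, hβ, -⟩ := exists_of_eigenvector hE hne' hY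
  have h1 : β = α := by
    funext j
    rw [← (q_pow_mul_t_pow_injective (hβ j)).1]
    rcases eq_or_ne j (lo i) with rfl | h1
    · rw [simple_lo, h]
    rcases eq_or_ne j (hi i) with rfl | h2
    · rw [simple_hi, h]
    rw [simple_of_ne i h1 h2]
  have h2 := (q_pow_mul_t_pow_injective (hβ (hi i))).2
  rw [h1, simple_hi, kExp_lo_of_eq i h] at h2
  omega

/-- Modulo `q`, the operator `T_i` sends `E_α` to `t E_{s_i α}` if `α_i ≤ α_{i+1}`. -/
theorem T_nonsymmetricMacdonald_congr {n : ℕ} {i : Fin (n - 1)} {α : Fin n → ℕ}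
    (h : α (lo i) ≤ α (hi i)) :
    CongrModQ (T i (nonsymmetricMacdonald α)) (t • nonsymmetricMacdonald (α ∘ simple i)) := by
  rcases h.eq_or_lt with h | h
  · have : α ∘ simple i = α := by
      funext j
      rcases eq_or_ne j (lo i) with rfl | h1
      · rw [act_simple_lo, h]
      rcases eq_or_ne j (hi i) with rfl | h2
      · rw [act_simple_hi, h]
      exact act_simple_of_ne i α j h1 h2
    rw [this, T_nonsymmetricMacdonald_of_eq h]
    exact CongrModQ.refl _
  · set β := α ∘ simple i with hβ
    have hα : α = β ∘ simple i := by
      funext j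
      simp only [hβ, Function.comp_apply, simple_simple]
    have hlt : β (hi i) < β (lo i) := by
      rwa [hβ, act_simple_lo, act_simple_hi]
    have hE := isTriangularMacdonald_nonsymmetricMacdonald (n := n)
    obtain ⟨e, he, hs⟩ := (hE β).swap hlt
    rw [← hα] at hs
    rw [(existsUnique_isNonsymmetricMacdonald α).unique (hE α).1 hs.1]
    refine ⟨e • T i (nonsymmetricMacdonald β),
      smul_mem_regularPoly he (T_mem_regularPoly i (hE β).2.2), ?_⟩
    -- By the quadratic relation `T_i (T_i + 1 - t) = t`, so only the term `q e T_i E_β` remains.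
    have hTT := LinearMap.congr_fun (T_mul_T i) (nonsymmetricMacdonald β)
    simp only [Module.End.mul_apply, LinearMap.add_apply, LinearMap.smul_apply,
      Module.End.one_apply] at hTT
    rw [map_add, map_smul, hTT]
    simp only [smul_eq_C_mul, map_sub, map_add, map_mul, map_one]
    ring

/-! ### Inversions and reduced expressions -/

/-- The number of inversions of a permutation. -/
def invNum {n : ℕ} (σ : Equiv.Perm (Fin n)) : ℕ :=
  (Finset.univ.filter fun p : Fin n × Fin n => p.1 < p.2 ∧ σ p.2 < σ p.1).card

theorem invNum_one {n : ℕ} : invNum (1 : Equiv.Perm (Fin n)) = 0 := by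
  rw [invNum, Finset.card_eq_zero, Finset.filter_eq_empty_iff]
  rintro p - ⟨h1, h2⟩
  exact lt_asymm h1 h2

theorem perm_inv_apply_self {n : ℕ} (σ : Equiv.Perm (Fin n)) (x : Fin n) : σ⁻¹ (σ x) = x :=
  σ.symm_apply_apply x

theorem perm_apply_inv_self {n : ℕ} (σ : Equiv.Perm (Fin n)) (x : Fin n) : σ (σ⁻¹ x) = x :=
  σ.apply_symm_apply x

/-- `s_i` reverses the order of no two values except `i` and `i + 1`, so multiplication by it on the
left creates exactly one inversion. -/
theorem simple_mul_apply_lt_iff {n : ℕ} {i : Fin (n - 1)} {σ : Equiv.Perm (Fin n)}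
    (h : σ⁻¹ (lo i) < σ⁻¹ (hi i)) {x y : Fin n} (hxy : x < y) :
    (simple i * σ) y < (simple i * σ) x ↔
      (x = σ⁻¹ (lo i) ∧ y = σ⁻¹ (hi i)) ∨ σ y < σ x := by
  simp only [Equiv.Perm.mul_apply, Equiv.Perm.eq_inv_iff_eq]
  constructor
  · intro h'
    by_cases hc : σ x = lo i ∧ σ y = hi i
    · exact Or.inl hc
    · right
      have := simple_lt i h' ?_
      · rwa [simple_simple, simple_simple] at this
      · rintro ⟨h1, h2⟩
        refine hc ⟨?_, ?_⟩
        · rw [← simple_simple i (σ x), h2, simple_hi]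
        · rw [← simple_simple i (σ y), h1, simple_lo]
  · rintro (⟨h1, h2⟩ | h')
    · rw [h1, h2, simple_lo, simple_hi, Fin.lt_def]
      exact Nat.lt_succ_self _
    · refine simple_lt i h' ?_
      rintro ⟨h1, h2⟩
      rw [← h1, ← h2, perm_inv_apply_self, perm_inv_apply_self] at h
      exact lt_asymm h hxy

theorem invNum_simple_mul_of_lt {n : ℕ} {i : Fin (n - 1)} {σ : Equiv.Perm (Fin n)}
    (h : σ⁻¹ (lo i) < σ⁻¹ (hi i)) : invNum (simple i * σ) = invNum σ + 1 := by
  classical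
  have e : (Finset.univ.filter fun p : Fin n × Fin n =>
      p.1 < p.2 ∧ (simple i * σ) p.2 < (simple i * σ) p.1) =
      insert (σ⁻¹ (lo i), σ⁻¹ (hi i))
        (Finset.univ.filter fun p : Fin n × Fin n => p.1 < p.2 ∧ σ p.2 < σ p.1) := by
    ext ⟨x, y⟩
    simp only [Finset.mem_filter, Finset.mem_univ, true_and, Finset.mem_insert, Prod.mk.injEq]
    constructor
    · rintro ⟨h1, h2⟩
      exact ((simple_mul_apply_lt_iff h h1).mp h2).imp_right fun h3 => ⟨h1, h3⟩
    · rintro (⟨rfl, rfl⟩ | ⟨h1, h2⟩)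
      · exact ⟨h, (simple_mul_apply_lt_iff h h).mpr (Or.inl ⟨rfl, rfl⟩)⟩
      · exact ⟨h1, (simple_mul_apply_lt_iff h h1).mpr (Or.inr h2)⟩
  rw [invNum, e, Finset.card_insert_of_notMem]
  · rfl
  · simp only [Finset.mem_filter, Finset.mem_univ, true_and, perm_apply_inv_self, not_and,
      not_lt]
    intro _
    rw [Fin.le_def]
    exact Nat.le_succ _

theorem simple_mul_cancel {n : ℕ} (i : Fin (n - 1)) (σ : Equiv.Perm (Fin n)) :
    simple i * (simple i * σ) = σ := by
  rw [← mul_assoc, simple_mul_self, one_mul]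

theorem simple_mul_inv_apply {n : ℕ} (i : Fin (n - 1)) (σ : Equiv.Perm (Fin n)) (x : Fin n) :
    (simple i * σ)⁻¹ x = σ⁻¹ (simple i x) := by
  rw [mul_inv_rev, simple_inv, Equiv.Perm.mul_apply]

theorem invNum_simple_mul_of_gt {n : ℕ} {i : Fin (n - 1)} {σ : Equiv.Perm (Fin n)}
    (h : σ⁻¹ (hi i) < σ⁻¹ (lo i)) : invNum σ = invNum (simple i * σ) + 1 := by
  conv_lhs => rw [← simple_mul_cancel i σ]
  apply invNum_simple_mul_of_lt
  rwa [simple_mul_inv_apply, simple_mul_inv_apply, simple_lo, simple_hi]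

theorem inv_lo_lt_or_gt {n : ℕ} (i : Fin (n - 1)) (σ : Equiv.Perm (Fin n)) :
    σ⁻¹ (lo i) < σ⁻¹ (hi i) ∨ σ⁻¹ (hi i) < σ⁻¹ (lo i) :=
  lt_or_gt_of_ne fun h => lo_ne_hi i (σ⁻¹.injective h)

theorem invNum_prod_le {n : ℕ} (w : List (Fin (n - 1))) :
    invNum (w.map simple).prod ≤ w.length := by
  induction w with
  | nil => rw [List.map_nil, List.prod_nil, invNum_one]; exact Nat.zero_le _
  | cons i w ih =>
    rw [List.map_cons, List.prod_cons, List.length_cons]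
    rcases inv_lo_lt_or_gt i (w.map simple).prod with h | h
    · rw [invNum_simple_mul_of_lt h]; omega
    · have := invNum_simple_mul_of_gt h; omega

theorem exists_descent {n : ℕ} {σ : Equiv.Perm (Fin n)} (h : σ ≠ 1) :
    ∃ i : Fin (n - 1), σ⁻¹ (hi i) < σ⁻¹ (lo i) := by
  by_contra! hcon
  rcases n with _ | n
  · exact h (Subsingleton.elim _ _)
  -- Without descents `σ⁻¹` is strictly increasing, and the only order automorphism of a finite
  -- chain is the identity.
  have hm : StrictMono (σ⁻¹ : Equiv.Perm (Fin (n + 1))) :=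
    Fin.strictMono_iff_lt_succ.mpr fun i =>
      ((inv_lo_lt_or_gt (n := n + 1) i σ).resolve_right (hcon i).not_gt)
  have h1 : (σ⁻¹ : Equiv.Perm (Fin (n + 1))) = 1 := by
    have h2 := Subsingleton.elim (hm.orderIsoOfSurjective _ (σ⁻¹).surjective) (OrderIso.refl _)
    exact Equiv.Perm.ext fun x => DFunLike.congr_fun h2 x
  exact h (inv_eq_one.mp h1)

theorem exists_word_length_eq {n : ℕ} (σ : Equiv.Perm (Fin n)) :
    ∃ w : List (Fin (n - 1)), (w.map simple).prod = σ ∧ w.length = invNum σ := by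
  induction hk : invNum σ using Nat.strong_induction_on generalizing σ with
  | _ k ih =>
  by_cases h : σ = 1
  · exact ⟨[], by simp [h], by rw [← hk, h, invNum_one]; rfl⟩
  · obtain ⟨i, hi'⟩ := exists_descent h
    have e := invNum_simple_mul_of_gt hi'
    obtain ⟨w, hw, hl⟩ := ih _ (by omega) (simple i * σ) rfl
    exact ⟨i :: w, by rw [List.map_cons, List.prod_cons, hw, simple_mul_cancel],
      by rw [List.length_cons]; omega⟩

theorem IsReduced.length_eq {n : ℕ} {w : List (Fin (n - 1))} {σ : Equiv.Perm (Fin n)}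
    (h : IsReduced w σ) : w.length = invNum σ := by
  obtain ⟨v, hv, hl⟩ := exists_word_length_eq σ
  refine le_antisymm (hl ▸ h.2 v hv) ?_
  have := invNum_prod_le w
  rwa [h.1] at this

/-- Each letter changes the number of inversions by one, up or down. A word as long as this number
therefore goes up at its first letter, and its tail has the same property. -/
theorem lo_lt_hi_of_cons {n : ℕ} {i : Fin (n - 1)} {w : List (Fin (n - 1))}
    (h : (i :: w).length = invNum ((i :: w).map simple).prod) :
    w.length = invNum (w.map simple).prod ∧
      ((w.map simple).prod)⁻¹ (lo i) < ((w.map simple).prod)⁻¹ (hi i) := by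
  rw [List.map_cons, List.prod_cons, List.length_cons] at h
  have h1 := invNum_prod_le w
  rcases inv_lo_lt_or_gt i (w.map simple).prod with h2 | h2
  · rw [invNum_simple_mul_of_lt h2] at h
    exact ⟨by omega, h2⟩
  · have := invNum_simple_mul_of_gt h2
    omega

/-- Two left descents let `σ` start with the longest element of the dihedral group generated by
`s_i` and `s_j`. The two reduced words differ only in that prefix, where a single braid or
commutation relation applies. -/
theorem exists_braid_of_descents {n : ℕ} {i j : Fin (n - 1)} (hij : i ≠ j)
    {σ : Equiv.Perm (Fin n)} (hi' : σ⁻¹ (hi i) < σ⁻¹ (lo i)) (hj' : σ⁻¹ (hi j) < σ⁻¹ (lo j)) :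
    ∃ c d : List (Fin (n - 1)), (c.map simple).prod = simple i * σ ∧
      c.length = invNum (simple i * σ) ∧ (d.map simple).prod = simple j * σ ∧
      d.length = invNum (simple j * σ) ∧ T i * (c.map T).prod = T j * (d.map T).prod := by
  wlog hlt : i < j generalizing i j
  · obtain ⟨c, d, h1, h2, h3, h4, h5⟩ := this hij.symm hj' hi' (hij.lt_or_gt.resolve_left hlt)
    exact ⟨d, c, h3, h4, h1, h2, h5.symm⟩
  rw [Fin.lt_def] at hlt
  have eij : invNum (simple i * σ) = invNum (simple j * σ) := by
    have := invNum_simple_mul_of_gt hi'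
    have := invNum_simple_mul_of_gt hj'
    omega
  by_cases hadj : i.1 + 1 = j.1
  · have e : lo j = hi i := Fin.ext hadj.symm
    have h3 : lo i ≠ hi j := by
      intro h'
      have := congrArg Fin.val h'
      simp [lo, hi] at this
      omega
    have e1 : simple i (hi j) = hi j := simple_of_ne i h3.symm (e ▸ (lo_ne_hi j).symm)
    have e2 : simple j (hi i) = hi j := e ▸ simple_lo j
    have e3 : simple j (lo i) = lo i := simple_of_ne j (e ▸ lo_ne_hi i) h3
    have d1 : (simple i * σ)⁻¹ (hi j) < (simple i * σ)⁻¹ (lo j) := by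
      rw [simple_mul_inv_apply, simple_mul_inv_apply, e1, e, simple_hi]
      exact hj'.trans (e ▸ hi')
    have d2 : (simple j * (simple i * σ))⁻¹ (hi i) < (simple j * (simple i * σ))⁻¹ (lo i) := by
      rw [simple_mul_inv_apply, simple_mul_inv_apply, simple_mul_inv_apply, simple_mul_inv_apply,
        e2, e1, e3, simple_lo, ← e]
      exact hj'
    have n1 := invNum_simple_mul_of_gt d1
    have n2 := invNum_simple_mul_of_gt d2
    obtain ⟨c, hc, hl⟩ := exists_word_length_eq (simple i * (simple j * (simple i * σ)))
    refine ⟨j :: i :: c, i :: j :: c, ?_, ?_, ?_, ?_, ?_⟩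
    · simp only [List.map_cons, List.prod_cons, hc, simple_mul_cancel]
    · simp only [List.length_cons]; omega
    · have hb : simple i * (simple j * (simple i * σ)) = simple j * (simple i * (simple j * σ)) := by
        simp only [← mul_assoc, simple_braid hadj]
      simp only [List.map_cons, List.prod_cons, hc]
      rw [hb, simple_mul_cancel, simple_mul_cancel]
    · simp only [List.length_cons]; omega
    · simp only [List.map_cons, List.prod_cons, ← mul_assoc, T_braid hadj]
  · have hlt' : i.1 + 1 < j.1 := by omega
    have e1 : simple i (lo j) = lo j := simple_of_ne i (by simp [lo, Fin.ext_iff]; omega)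
      (by simp [lo, hi, Fin.ext_iff]; omega)
    have e2 : simple i (hi j) = hi j := simple_of_ne i (by simp [lo, hi, Fin.ext_iff]; omega)
      (by simp [hi, Fin.ext_iff]; omega)
    have d1 : (simple i * σ)⁻¹ (hi j) < (simple i * σ)⁻¹ (lo j) := by
      rwa [simple_mul_inv_apply, simple_mul_inv_apply, e1, e2]
    have n1 := invNum_simple_mul_of_gt d1
    obtain ⟨c, hc, hl⟩ := exists_word_length_eq (simple j * (simple i * σ))
    refine ⟨j :: c, i :: c, ?_, ?_, ?_, ?_, ?_⟩
    · simp only [List.map_cons, List.prod_cons, hc, simple_mul_cancel]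
    · simp only [List.length_cons]; omega
    · simp only [List.map_cons, List.prod_cons, hc]
      rw [← mul_assoc (simple j), ← simple_comm hlt', mul_assoc, simple_mul_cancel]
    · simp only [List.length_cons]; omega
    · simp only [List.map_cons, List.prod_cons, ← mul_assoc, T_comm hlt']

/-- Matsumoto's theorem for the Demazure–Lusztig operators. -/
theorem prod_map_T_eq_of_reduced {n : ℕ} (a b : List (Fin (n - 1)))
    (hab : (a.map simple).prod = (b.map simple).prod)
    (ha : a.length = invNum (a.map simple).prod) (hb : b.length = invNum (b.map simple).prod) :
    (a.map T).prod = (b.map T).prod := by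
  induction hk : a.length using Nat.strong_induction_on generalizing a b with
  | _ k ih =>
  have hlen : a.length = b.length := by rw [ha, hb, hab]
  rcases a with _ | ⟨i, a⟩
  · rw [List.eq_nil_of_length_eq_zero hlen.symm]
  rcases b with _ | ⟨j, b⟩
  · simp at hlen
  obtain ⟨ha', hia⟩ := lo_lt_hi_of_cons ha
  obtain ⟨hb', hjb⟩ := lo_lt_hi_of_cons hb
  simp only [List.map_cons, List.prod_cons, List.length_cons] at hab ha hb hlen hk ⊢
  have eu := simple_mul_cancel i (a.map simple).prod
  have ev := simple_mul_cancel j (b.map simple).prod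
  rcases eq_or_ne i j with rfl | hij
  · rw [ih a.length (by omega) a b (mul_left_cancel hab) ha' hb' rfl]
  · set σ := simple i * (a.map simple).prod with hσ
    have h1 : σ⁻¹ (hi i) < σ⁻¹ (lo i) := by
      rwa [hσ, simple_mul_inv_apply, simple_mul_inv_apply, simple_lo, simple_hi]
    have h2 : σ⁻¹ (hi j) < σ⁻¹ (lo j) := by
      rwa [hab, simple_mul_inv_apply, simple_mul_inv_apply, simple_lo, simple_hi]
    obtain ⟨c, d, hc, hcl, hd, hdl, hT⟩ := exists_braid_of_descents hij h1 h2
    rw [ih a.length (by omega) a c (by rw [hc, eu]) ha' (by rw [hc, hcl]) rfl,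
      ih b.length (by omega) b d (by rw [hd, hab, ev]) hb' (by rw [hd, hdl]) rfl, hT]

theorem prod_map_T_eq_TPerm {n : ℕ} {w : List (Fin (n - 1))} {σ : Equiv.Perm (Fin n)}
    (hw : (w.map simple).prod = σ) (hl : w.length = invNum σ) : (w.map T).prod = TPerm σ := by
  have h := (exists_isReduced σ).choose_spec
  exact prod_map_T_eq_of_reduced w (reducedWord σ) (hw.trans h.1.symm) (by rw [hw, hl])
    (by rw [reducedWord, h.1, h.length_eq])

theorem TPerm_mul {n : ℕ} {σ ρ : Equiv.Perm (Fin n)}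
    (h : invNum (σ * ρ) = invNum σ + invNum ρ) :
    (TPerm (σ * ρ) : Module.End Qqt (Poly n)) = TPerm σ * TPerm ρ := by
  obtain ⟨a, ha, hal⟩ := exists_word_length_eq σ
  obtain ⟨b, hb, hbl⟩ := exists_word_length_eq ρ
  rw [← prod_map_T_eq_TPerm ha hal, ← prod_map_T_eq_TPerm hb hbl,
    ← prod_map_T_eq_TPerm (w := a ++ b), List.map_append, List.prod_append]
  · rw [List.map_append, List.prod_append, ha, hb]
  · rw [List.length_append, hal, hbl, h]

theorem TPerm_one {n : ℕ} : (TPerm (1 : Equiv.Perm (Fin n)) : Module.End Qqt (Poly n)) = 1 :=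
  (prod_map_T_eq_TPerm (w := []) rfl invNum_one.symm).symm

theorem prod_map_T_mem_regularPoly {n : ℕ} (w : List (Fin (n - 1))) {f : Poly n}
    (hf : f ∈ regularPoly n) : (w.map T).prod f ∈ regularPoly n := by
  induction w with
  | nil => exact hf
  | cons i w ih =>
    rw [List.map_cons, List.prod_cons, Module.End.mul_apply]
    exact T_mem_regularPoly i ih

theorem CongrModQ.map_TPerm {n : ℕ} (σ : Equiv.Perm (Fin n)) {f g : Poly n}
    (h : CongrModQ f g) : CongrModQ (TPerm σ f) (TPerm σ g) := by
  unfold TPerm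
  induction reducedWord σ with
  | nil => exact h
  | cons i w ih =>
    rw [List.map_cons, List.prod_cons, Module.End.mul_apply, Module.End.mul_apply]
    exact ih.map_T i

theorem prod_map_T_nonsymmetricMacdonald_congr {n : ℕ} (w : List (Fin (n - 1)))
    (hw : w.length = invNum (w.map simple).prod) (α : Fin n → ℕ)
    (hα : ∀ x y, x < y → (w.map simple).prod y < (w.map simple).prod x → α x ≤ α y) :
    CongrModQ ((w.map T).prod (nonsymmetricMacdonald α))
      (t ^ w.length • nonsymmetricMacdonald (α ∘ ⇑((w.map simple).prod)⁻¹)) := by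
  induction w with
  | nil =>
    rw [List.length_nil, pow_zero, one_smul]
    exact CongrModQ.refl _
  | cons i w ih =>
    obtain ⟨hw', hlt⟩ := lo_lt_hi_of_cons hw
    simp only [List.map_cons, List.prod_cons] at hα ⊢
    set σ := (w.map simple).prod
    have h1 := ih hw' fun x y hxy hσ => hα x y hxy
      ((simple_mul_apply_lt_iff hlt hxy).mpr (Or.inr hσ))
    -- The one inversion that `s_i` adds sits at these positions, so the hypothesis compares exactly
    -- the two entries that `T_i` is about to exchange.
    have h2 : α (σ⁻¹ (lo i)) ≤ α (σ⁻¹ (hi i)) := hα _ _ hlt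
      ((simple_mul_apply_lt_iff hlt hlt).mpr (Or.inl ⟨rfl, rfl⟩))
    have h3 := T_nonsymmetricMacdonald_congr (i := i) (α := α ∘ ⇑σ⁻¹) h2
    have e : α ∘ ⇑(simple i * σ)⁻¹ = (α ∘ ⇑σ⁻¹) ∘ ⇑(simple i) :=
      funext fun x => congrArg α (simple_mul_inv_apply i σ x)
    rw [Module.End.mul_apply, List.length_cons, e, pow_succ, mul_smul]
    refine (h1.map_T i).trans ?_
    rw [map_smul]
    exact h3.smul (pow_mem t_mem _)

/-- Modulo `q`, the operator `T_σ` sends `E_α` to `t^{ℓ(σ)} E_{σ · α}` if `α_x ≤ α_y` for every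
inversion `x < y` of `σ`. -/
theorem TPerm_nonsymmetricMacdonald_congr {n : ℕ} (σ : Equiv.Perm (Fin n)) (α : Fin n → ℕ)
    (hα : ∀ x y, x < y → σ y < σ x → α x ≤ α y) :
    CongrModQ (TPerm σ (nonsymmetricMacdonald α))
      (t ^ invNum σ • nonsymmetricMacdonald (act σ α)) := by
  obtain ⟨w, rfl, hl⟩ := exists_word_length_eq σ
  rw [← prod_map_T_eq_TPerm rfl hl, ← hl]
  exact prod_map_T_nonsymmetricMacdonald_congr w hl α hα

/-! ### Counting inversions -/

theorem card_filter_comp_perm {n : ℕ} (σ : Equiv.Perm (Fin n)) (p : Fin n → Fin n → Prop)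
    [∀ x y, Decidable (p x y)] :
    (Finset.univ.filter fun a : Fin n × Fin n => p (σ a.1) (σ a.2)).card =
      (Finset.univ.filter fun a : Fin n × Fin n => p a.1 a.2).card :=
  Finset.card_equiv (σ.prodCongr σ) fun a => by simp

theorem card_filter_swap {n : ℕ} (p : Fin n → Fin n → Prop) [∀ x y, Decidable (p x y)] :
    (Finset.univ.filter fun a : Fin n × Fin n => p a.2 a.1).card =
      (Finset.univ.filter fun a : Fin n × Fin n => p a.1 a.2).card :=
  Finset.card_equiv (Equiv.prodComm _ _) fun a => by simp

theorem w0_apply {n : ℕ} (x : Fin n) : w0 n x = Fin.rev x := rfl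

theorem w0_mul_w0 (n : ℕ) : w0 n * w0 n = 1 :=
  Equiv.ext fun x => Fin.rev_rev x

theorem w0_inv (n : ℕ) : (w0 n)⁻¹ = w0 n := inv_eq_of_mul_eq_one_right (w0_mul_w0 n)

theorem invNum_inv {n : ℕ} (σ : Equiv.Perm (Fin n)) : invNum σ⁻¹ = invNum σ := by
  unfold invNum
  rw [← card_filter_comp_perm σ fun x y => x < y ∧ σ⁻¹ y < σ⁻¹ x]
  simp only [perm_inv_apply_self]
  rw [← card_filter_swap fun x y => x < y ∧ σ y < σ x]
  simp only [and_comm]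

theorem invNum_w0_conj {n : ℕ} (σ : Equiv.Perm (Fin n)) :
    invNum (w0 n * σ * w0 n) = invNum σ := by
  unfold invNum
  rw [← card_filter_comp_perm (w0 n) fun x y =>
    x < y ∧ (w0 n * σ * w0 n) y < (w0 n * σ * w0 n) x]
  simp only [Equiv.Perm.mul_apply, w0_apply, Fin.rev_rev, Fin.rev_lt_rev]
  rw [← card_filter_swap fun x y => x < y ∧ σ y < σ x]

theorem invNum_mul_w0 {n : ℕ} (σ : Equiv.Perm (Fin n)) :
    invNum (σ * w0 n) =
      (Finset.univ.filter fun p : Fin n × Fin n => p.1 < p.2 ∧ σ p.1 < σ p.2).card := by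
  unfold invNum
  rw [← card_filter_comp_perm (w0 n) fun x y => x < y ∧ (σ * w0 n) y < (σ * w0 n) x]
  simp only [Equiv.Perm.mul_apply, w0_apply, Fin.rev_rev, Fin.rev_lt_rev]
  rw [← card_filter_swap fun x y => x < y ∧ σ x < σ y]

/-- Each pair of positions is an inversion of exactly one of `σ` and its reversal. -/
theorem invNum_mul_w0_add {n : ℕ} (σ : Equiv.Perm (Fin n)) :
    invNum (σ * w0 n) + invNum σ = invNum (w0 n) := by
  rw [invNum_mul_w0, invNum, ← one_mul (w0 n), invNum_mul_w0, Finset.card_filter,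
    Finset.card_filter, Finset.card_filter, ← Finset.sum_add_distrib]
  refine Finset.sum_congr rfl fun p _ => ?_
  rcases lt_trichotomy (σ p.1) (σ p.2) with h | h | h
  · simp [h, h.not_gt]
  · simp [σ.injective h]
  · simp [h, h.not_gt]

/-- After substitution along `τ`, the pairs counted on the left split by the order of the original
positions. Those in order give `twinv ι τ`; for those out of order the condition on the entries is
automatic by monotonicity, and they are the inversions of `τ`. -/
theorem twinv_one_eq {n : ℕ} {ι : Fin n → ℕ} (hι : Monotone ι) (τ : Equiv.Perm (Fin n)) :
    twinv (act τ ι) 1 = twinv ι τ + invNum τ := by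
  unfold twinv invNum
  rw [← card_filter_comp_perm τ fun x y => x < y ∧ act τ ι y ≤ act τ ι x ∧
    (1 : Equiv.Perm (Fin n)) x < (1 : Equiv.Perm (Fin n)) y,
    ← card_filter_swap fun x y => x < y ∧ τ y < τ x, Finset.card_filter,
    Finset.card_filter, Finset.card_filter, ← Finset.sum_add_distrib]
  refine Finset.sum_congr rfl fun p _ => ?_
  simp only [act, perm_inv_apply_self, Equiv.Perm.one_apply]
  rcases lt_trichotomy p.1 p.2 with h | h | h
  · simp only [h, h.not_gt, true_and, false_and, if_false, add_zero]
    exact if_congr (by tauto) rfl rfl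
  · simp [h]
  · simp [h, h.not_gt, hι h.le]

/-! ### The main theorem -/

theorem permutedMacdonald_mem_regularPoly {n : ℕ} (α : Fin n → ℕ) (σ : Equiv.Perm (Fin n)) :
    permutedMacdonald α σ ∈ regularPoly n :=
  smul_mem_regularPoly (pow_mem t_inv_mem _)
    (prod_map_T_mem_regularPoly _ (nonsymmetricMacdonald_mem_regularPoly _))

theorem rev_rev {n : ℕ} (α : Fin n → ℕ) : rev (rev α) = α :=
  funext fun x => congrArg α (Fin.rev_rev x)

theorem tAtom_act {n : ℕ} {ι : Fin n → ℕ} (hι : Monotone ι) (τ : Equiv.Perm (Fin n)) :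
    tAtom (act τ ι) = permutedAtom ι τ := by
  refine CongrModQ.specialize_eq (permutedMacdonald_mem_regularPoly _ _) ?_
  -- Chosen so that `w₀ = (τ w₀) ρ` and `ρ` sends `rev α` to `rev ι`. Its length is that of `τ`, so
  -- the factorization is length-additive and `T_{w₀}` splits.
  set ρ := w0 n * τ⁻¹ * w0 n with hρ
  have h1 : invNum ρ = invNum τ := by rw [hρ, invNum_w0_conj, invNum_inv]
  have h2 : revPerm 1 = revPerm τ * ρ := by
    rw [revPerm, revPerm, hρ, one_mul, mul_assoc, mul_assoc, ← mul_assoc (w0 n) (w0 n), w0_mul_w0,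
      one_mul, mul_inv_cancel_left]
  have h3 : invNum (revPerm τ * ρ) = invNum (revPerm τ) + invNum ρ := by
    rw [← h2, h1, revPerm, revPerm, one_mul, invNum_mul_w0_add]
  have h4 : act ρ (rev (act τ ι)) = rev ι := by
    funext x
    simp only [act, rev, hρ, mul_inv_rev, inv_inv, w0_inv, Equiv.Perm.mul_apply, w0_apply,
      Fin.rev_rev, perm_inv_apply_self]
  have h5 : ∀ x, rev (act τ ι) x = ι (Fin.rev (ρ x)) := fun x => by
    simp only [act, rev, hρ, Equiv.Perm.mul_apply, w0_apply, Fin.rev_rev]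
  -- By `h5`, the entries of `rev α` decrease weakly as functions of the value of `ρ`, so inversions
  -- of `ρ` meet weakly increasing pairs.
  have h6 := TPerm_nonsymmetricMacdonald_congr ρ (rev (act τ ι)) fun x y _ h => by
    rw [h5, h5]
    exact hι (Fin.rev_le_rev.mpr h.le)
  rw [h4, h1] at h6
  have h7 := (h6.map_TPerm (revPerm τ)).smul (pow_mem t_inv_mem (twinv (act τ ι) 1))
  rw [permutedMacdonald, permutedMacdonald, h2, TPerm_mul h3, Module.End.mul_apply]
  rw [map_smul, smul_smul, twinv_one_eq hι, pow_add, mul_assoc, ← mul_pow,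
    inv_mul_cancel₀ t_ne_zero, one_pow, mul_one] at h7
  rwa [twinv_one_eq hι, pow_add]

theorem twinv_w0 {n : ℕ} (α : Fin n → ℕ) : twinv α (w0 n) = 0 := by
  rw [twinv, Finset.card_eq_zero, Finset.filter_eq_empty_iff]
  rintro p - ⟨h1, -, h2⟩
  rw [w0_apply, w0_apply, Fin.rev_lt_rev] at h2
  exact lt_asymm h1 h2

theorem twinv_of_antitone {n : ℕ} {δ : Fin n → ℕ} (hδ : Antitone δ) (π : Equiv.Perm (Fin n)) :
    twinv δ π = invNum (revPerm π) := by
  rw [revPerm, invNum_mul_w0, twinv]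
  congr 1
  refine Finset.filter_congr fun p _ => and_congr_right fun h => ?_
  exact and_iff_right (hδ h.le)

/-- For the basement `w₀` both the operator and the power of `t` are trivial, so the key is
`E_{π·δ}` at `q = 0`. On the other side `rev δ` is increasing, so the congruence holds for every
permutation, and `twinv δ π` is exactly the length of `π w₀`. -/
theorem tKey_act {n : ℕ} {δ : Fin n → ℕ} (hδ : Antitone δ) (π : Equiv.Perm (Fin n)) :
    tKey (rev (act π δ)) = permutedAtom δ π := by
  refine (CongrModQ.specialize_eq (permutedMacdonald_mem_regularPoly _ _) ?_).symm
  have h1 : act (revPerm π) (rev δ) = act π δ := by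
    funext x
    simp only [act, rev, revPerm, mul_inv_rev, w0_inv, Equiv.Perm.mul_apply, w0_apply, Fin.rev_rev]
  have h2 := TPerm_nonsymmetricMacdonald_congr (revPerm π) (rev δ) fun x y h _ =>
    hδ (Fin.rev_le_rev.mpr h.le)
  have h3 := h2.smul (pow_mem t_inv_mem (twinv δ π))
  rw [h1, twinv_of_antitone hδ, smul_smul, ← mul_pow, inv_mul_cancel₀ t_ne_zero, one_pow,
    one_smul] at h3
  rw [permutedMacdonald, permutedMacdonald, twinv_of_antitone hδ, twinv_w0, rev_rev,
    show revPerm (w0 n) = 1 from w0_mul_w0 n, TPerm_one, pow_zero, one_smul, Module.End.one_apply]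
  exact h3

end

end PermutedBasement

theorem mainTheorem5 (n : ℕ) (α : Fin n → ℕ) :
    (∀ (β : Fin n → ℕ),
      (∃! E : PermutedBasement.Poly n, PermutedBasement.IsNonsymmetricMacdonald β E) ∧
      ∀ (σ : Equiv.Perm (Fin n)) (m : Fin n →₀ ℕ), PermutedBasement.RegularAtZero
        (MvPolynomial.coeff m (PermutedBasement.permutedMacdonald β σ))) ∧
    (∀ τ : Equiv.Perm (Fin n),
      PermutedBasement.act τ (PermutedBasement.inc α) = α →
        PermutedBasement.tAtom α =
          PermutedBasement.permutedAtom (PermutedBasement.inc α) τ) ∧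
    (∀ π : Equiv.Perm (Fin n),
      PermutedBasement.act π (PermutedBasement.dec α) = α →
        PermutedBasement.tKey (PermutedBasement.rev α) =
          PermutedBasement.permutedAtom (PermutedBasement.dec α) π) := by
  refine ⟨fun β => ⟨PermutedBasement.existsUnique_isNonsymmetricMacdonald β, fun σ =>
    PermutedBasement.permutedMacdonald_mem_regularPoly β σ⟩, fun τ hτ => ?_, fun π hπ => ?_⟩
  · have h := PermutedBasement.tAtom_act (PermutedBasement.inc_monotone α) τ
    rwa [hτ] at h
  · have h := PermutedBasement.tKey_act (PermutedBasement.dec_antitone α) π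
    rwa [hπ] at h
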